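/- Let $k$ be a field, $H$ a cocommutative Hopf algebra over $k$ with antipode $S$ (so $S^2=\mathrm{id}$), and $A$ a right $H$-comodule algebra with coaction $a\mapsto a_{[0]}\otimes a_{[1]}$ and algebra of coinvariants $B=\{b\in A : b_{[0]}\otimes b_{[1]}=b\otimes 1\}$. Assume that $A$ is a faithfully flat $H$-Galois extension of $B$: the canonical map $\mathrm{can}\colon A\otimes_B A\to A\otimes H$, $a\otimes a'\mapsto aa'_{[0]}\otimes a'_{[1]}$, is bijective and $A$ is faithfully flat as a left $B$-module. Write $\sum_i l_i(h)\otimes_B r_i(h)=\mathrm{can}^{-1}(1\otimes h)$ for $h\in H$. The center $Z(B)$ is a left $H$-module algebra under the Miyashita–Ulbrich action $h\cdot x=\sum_i l_i(S^{-1}(h))\,x\,r_i(S^{-1}(h))$. *Stability.* The algebra $A^{\rm op}$ is a comodule algebra with coaction $a\mapsto a_{[0]}\otimes S(a_{[1]})$. Put $B^e=B\otimes B^{\rm op}$ and $$A^{\square e}=\Bigl\{\textstyle\sum_k a_k\otimes a'_k\in A\otimes A^{\rm op} : \sum_k a_{k[0]}\otimes a'_k\otimes a_{k[1]}=\sum_k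 a_k\otimes a'_{k[0]}\otimes S(a'_{k[1]})\Bigr\},$$ an algebra containing $B^e$, with coaction $\sum_k a_k\otimes a'_k\mapsto\sum_k (a_{k[0]}\otimes a'_k)\otimes a_{k[1]}$. For a $B$-bimodule $M$ (with $k$ acting centrally), $A^{\square e}\otimes_{B^e}M$ and $M\otimes H$ are $B$-bimodules (through the left multiplication on $A^{\square e}$, respectively the bimodule structure of $M$) and $H$-comodules (through $A^{\square e}$, respectively $H$). Given $H$-colinear bimodule isomorphisms $\varphi_M\colon A^{\square e}\otimes_{B^e}M\to M\otimes H$ and $\varphi_N\colon A^{\square e}\otimes_{B^e}N\to N\otimes H$, let $\varphi_{M\otimes_B N}\colon A^{\square e}\otimes_{B^e}(M\otimes_B N)\to (M\otimes_B N)\otimes H$ be the map with $\kappa\circ\varphi_{M\otimes_BN}=(\varphi_M\otimes_B\varphi_N)\circ g$, where $\kappa(m\otimes n\otimes h)=(m\otimes h_{(1)})\otimes_B(n\otimes h_{(2)})$ and $$g\Bigl(\bigl(\textstyle\sum_k a_k\otimes a'_k\bigr)\otimes (m\otimes n)\Bigr)=\sum_{i,k}\bigl((a_{k[0]}\otimes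 l_i(a_{k[1]}))\otimes m\bigr)\otimes_B\bigl((r_i(a_{k[1]})\otimes a'_k)\otimes n\bigr),$$ the sum being read in the image of $A^{\square e}\otimes_B A^{\square e}$ (which embeds in $A^e\otimes_B A^e$, $A^e=A\otimes A^{\rm op}$, and contains $\sum_{i,k}(a_{k[0]}\otimes l_i(a_{k[1]}))\otimes_B(r_i(a_{k[1]})\otimes a'_k)$). Let $\varphi_B\colon A^{\square e}\otimes_{B^e}B\to B\otimes H$ be the map $(\sum_k a_k\otimes a'_k)\otimes b\mapsto\sum_k a_{k[0]}\,b\,a'_k\otimes a_{k[1]}$. A strict Morita context $(B,B,M,N,\alpha,\beta)$ is *$H$-stable* if there are such isomorphisms $\varphi_M$ and $\varphi_N$ with $$\varphi_B\circ(A^{\square e}\otimes_{B^e}\alpha)=(\alpha\otimes H)\circ\varphi_{M\otimes_BN},\qquad \varphi_B\circ(A^{\square e}\otimes_{B^e}\beta)=(\beta\otimes H)\circ\varphi_{N\otimes_BM}.$$ Let $\mathrm{Pic}(B)$ be the group of isomorphism classes of invertible $B$-bimodules, and $\mathrm{Pic}(B)^H$ its subgroup generated by the classes $[M]$ of the $H$-stable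 strict Morita contexts $(B,B,M,N,\alpha,\beta)$ (these classes in fact form a subgroup). *Sweedler cohomology.* Let $H^{\otimes n}$ carry the tensor product coalgebra structure. For $n\ge 0$ let $C^n$ be the abelian group, under convolution, of convolution invertible linear maps $H^{\otimes n}\to Z(B)$, and let $d\colon C^n\to C^{n+1}$ be the homomorphism for which $df$ is the convolution product of the map $h_0\otimes\cdots\otimes h_n\mapsto h_0\cdot f(h_1\otimes\cdots\otimes h_n)$, of the maps $h_0\otimes\cdots\otimes h_n\mapsto f^{(-1)^{i+1}}(h_0\otimes\cdots\otimes h_ih_{i+1}\otimes\cdots\otimes h_n)$ for $0\le i<n$, and of the map $h_0\otimes\cdots\otimes h_n\mapsto f^{(-1)^{n+1}}(h_0\otimes\cdots\otimes h_{n-1})\,\varepsilon(h_n)$, where powers are convolution powers. Put $Z^n(H,Z(B))=\ker(d\colon C^n\to C^{n+1})$, $B^n(H,Z(B))=\mathrm{im}(d\colon C^{n-1}\to C^n)$ (trivial for $n=0$), and $H^n(H,Z(B))=Z^n(H,Z(B))/B^n(H,Z(B))$. **Proposition.** There is an action of the group $\mathrm{Pic}(B)$ on $Z(B)$ by $k$-algebra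 automorphisms, $[M]\mapsto\xi_M$, characterized by $$\xi_M(x)=y\iff mx=ym\ \text{ for all } m\in M\qquad(x,y\in Z(B)).$$ If the strict Morita context $(B,B,M,N,\alpha,\beta)$ is $H$-stable, then $\xi_M(h\cdot x)=h\cdot\xi_M(x)$ for all $h\in H$ and $x\in Z(B)$. For every $n\ge 0$, the action of $\mathrm{Pic}(B)$ on $Z(B)$ induces actions of $\mathrm{Pic}(B)^H$ by group automorphisms on $Z^n(H,Z(B))$, $B^n(H,Z(B))$ and $H^n(H,Z(B))$: if $p\in\mathrm{Pic}(B)^H$ acts on $Z(B)$ by $\xi_p$, and $f\colon H^{\otimes n}\to Z(B)$ is a cocycle (resp. a coboundary), then $\xi_p\circ f$ is a cocycle (resp. a coboundary), $p$ acts on $Z^n(H,Z(B))$ and on $B^n(H,Z(B))$ by $f\mapsto\xi_p\circ f$, and on $H^n(H,Z(B))$ by $[f]\mapsto[\xi_p\circ f]$. -/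

import Mathlib

open TensorProduct MulOpposite

universe u v w w' w'' w₁ w₂

namespace HPicard

noncomputable section

section Balanced

variable {k : Type*} [Field k] {R : Type*} [Ring R] [Algebra k R]
variable {X X' X'' Y Y' Y'' Z : Type*}
variable [AddCommGroup X] [Module k X] [AddCommGroup X'] [Module k X']
variable [AddCommGroup X''] [Module k X''] [AddCommGroup Y''] [Module k Y'']
variable [AddCommGroup Y] [Module k Y] [AddCommGroup Y'] [Module k Y']
variable [AddCommGroup Z] [Module k Z]

/-- Right (left) modules over the `k`-algebra `R` are given by a `k`-space `X` (`Y`) with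
an algebra map `r : Rᵐᵒᵖ → End X` (`l : R → End Y`): `x * a = r (op a) x` and `a * y = l a y`.
This is the subspace of `X ⊗[k] Y` spanned by all `x * a ⊗ y - x ⊗ a * y`. -/
def balancedRel (r : Rᵐᵒᵖ →ₐ[k] Module.End k X) (l : R →ₐ[k] Module.End k Y) :
    Submodule k (X ⊗[k] Y) :=
  Submodule.span k {z | ∃ (x : X) (a : R) (y : Y), z = r (op a) x ⊗ₜ[k] y - x ⊗ₜ[k] l a y}

/-- The tensor product `X ⊗_R Y` over a (noncommutative) `k`-algebra `R`. -/
abbrev Balanced (r : Rᵐᵒᵖ →ₐ[k] Module.End k X) (l : R →ₐ[k] Module.End k Y) : Type _ :=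
  (X ⊗[k] Y) ⧸ balancedRel r l

namespace Balanced

variable {r : Rᵐᵒᵖ →ₐ[k] Module.End k X} {l : R →ₐ[k] Module.End k Y}
variable {r' : Rᵐᵒᵖ →ₐ[k] Module.End k X'} {l' : R →ₐ[k] Module.End k Y'}
variable {r'' : Rᵐᵒᵖ →ₐ[k] Module.End k X''} {l'' : R →ₐ[k] Module.End k Y''}

variable (r l) in
/-- The pure tensor `x ⊗_R y`. -/
def tmul (x : X) (y : Y) : Balanced r l := Submodule.Quotient.mk (x ⊗ₜ[k] y)

theorem mk_tmul (x : X) (y : Y) :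
    Submodule.Quotient.mk (p := balancedRel r l) (x ⊗ₜ[k] y) = tmul r l x y := rfl

theorem tmul_act (x : X) (a : R) (y : Y) : tmul r l (r (op a) x) y = tmul r l x (l a y) :=
  (Submodule.Quotient.eq _).2 (Submodule.subset_span ⟨x, a, y, rfl⟩)

variable (r l) in
/-- `tmul` as a bilinear map. -/
def tmulHom : X →ₗ[k] Y →ₗ[k] Balanced r l :=
  (TensorProduct.mk k X Y).compr₂ (balancedRel r l).mkQ

@[simp] theorem tmulHom_apply (x : X) (y : Y) : tmulHom r l x y = tmul r l x y := rfl

@[simp] theorem add_tmul (x x' : X) (y : Y) :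
    tmul r l (x + x') y = tmul r l x y + tmul r l x' y := by
  simp [← tmulHom_apply]

@[simp] theorem tmul_add (x : X) (y y' : Y) :
    tmul r l x (y + y') = tmul r l x y + tmul r l x y' := by
  simp [← tmulHom_apply]

@[simp] theorem smul_tmul (c : k) (x : X) (y : Y) :
    tmul r l (c • x) y = c • tmul r l x y := by
  simp [← tmulHom_apply]

@[simp] theorem tmul_smul (c : k) (x : X) (y : Y) :
    tmul r l x (c • y) = c • tmul r l x y := by
  simp [← tmulHom_apply]

theorem hom_ext {f g : Balanced r l →ₗ[k] Z}
    (h : ∀ x y, f (tmul r l x y) = g (tmul r l x y)) : f = g := by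
  apply Submodule.linearMap_qext
  ext x y
  exact h x y

theorem hom_ext_apply {f g : Balanced r l →ₗ[k] Z}
    (h : ∀ x y, f (tmul r l x y) = g (tmul r l x y)) (z : Balanced r l) : f z = g z := by
  rw [hom_ext h]

/-- The universal property of `X ⊗_R Y`. -/
def lift (f : X →ₗ[k] Y →ₗ[k] Z) (hf : ∀ x a y, f (r (op a) x) y = f x (l a y)) :
    Balanced r l →ₗ[k] Z :=
  (balancedRel r l).liftQ (TensorProduct.lift f) (by
    rw [balancedRel, Submodule.span_le]
    rintro _ ⟨x, a, y, rfl⟩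
    simp [hf])

@[simp] theorem lift_tmul (f : X →ₗ[k] Y →ₗ[k] Z) (hf) (x : X) (y : Y) :
    lift (r := r) (l := l) f hf (tmul r l x y) = f x y := by
  change (balancedRel r l).liftQ (TensorProduct.lift f) _ (Submodule.Quotient.mk _) = _
  simp

/-- The map `f ⊗_R g`, for `R`-linear `f` and `g`. -/
def map (f : X →ₗ[k] X') (g : Y →ₗ[k] Y') (hf : ∀ a x, f (r a x) = r' a (f x))
    (hg : ∀ a y, g (l a y) = l' a (g y)) : Balanced r l →ₗ[k] Balanced r' l' :=
  lift ((tmulHom r' l').compl₁₂ f g) (by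
    intro x a y
    simp [hf, hg, tmul_act])

@[simp] theorem map_tmul (f : X →ₗ[k] X') (g : Y →ₗ[k] Y') (hf) (hg) (x : X) (y : Y) :
    map (r := r) (l := l) (r' := r') (l' := l') f g hf hg (tmul r l x y) =
      tmul r' l' (f x) (g y) := by
  simp [map]

theorem induction {p : Balanced r l → Prop} (tmul : ∀ x y, p (tmul r l x y))
    (add : ∀ z z', p z → p z' → p (z + z')) (z : Balanced r l) : p z := by
  obtain ⟨z, rfl⟩ := Submodule.Quotient.mk_surjective _ z
  induction z with
  | zero => simpa [Balanced.tmul] using tmul 0 0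
  | tmul x y => exact tmul x y
  | add z z' hz hz' => exact add _ _ hz hz'

variable (r) in
/-- Endomorphisms of `Y` commuting with the `R`-action act on `X ⊗_R Y`. -/
def actRight {S : Type*} [Ring S] [Algebra k S] (l : R →ₐ[k] Module.End k Y)
    (s : S →ₐ[k] Module.End k Y) (h : ∀ a c y, s c (l a y) = l a (s c y)) :
    S →ₐ[k] Module.End k (Balanced r l) :=
  AlgHom.ofLinearMap
    { toFun := fun c => map LinearMap.id (s c) (fun _ _ => rfl) (fun a y => h a c y)
      map_add' := fun c d => hom_ext (by simp)
      map_smul' := fun c d => hom_ext (by simp) }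
    (hom_ext (by simp)) (fun c d => hom_ext (by simp))

@[simp] theorem actRight_tmul {S : Type*} [Ring S] [Algebra k S]
    (s : S →ₐ[k] Module.End k Y) (h : ∀ a c y, s c (l a y) = l a (s c y))
    (c : S) (x : X) (y : Y) :
    actRight r l s h c (tmul r l x y) = tmul r l x (s c y) := by
  simp [actRight]

/-- Endomorphisms of `X` commuting with the `R`-action act on `X ⊗_R Y`. -/
def actLeft {S : Type*} [Ring S] [Algebra k S] (r : Rᵐᵒᵖ →ₐ[k] Module.End k X)
    (l : R →ₐ[k] Module.End k Y)
    (s : S →ₐ[k] Module.End k X) (h : ∀ a c x, s c (r a x) = r a (s c x)) :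
    S →ₐ[k] Module.End k (Balanced r l) :=
  AlgHom.ofLinearMap
    { toFun := fun c => map (s c) LinearMap.id (fun a y => h a c y) (fun _ _ => rfl)
      map_add' := fun c d => hom_ext (by simp)
      map_smul' := fun c d => hom_ext (by simp) }
    (hom_ext (by simp)) (fun c d => hom_ext (by simp))

@[simp] theorem actLeft_tmul {S : Type*} [Ring S] [Algebra k S]
    (s : S →ₐ[k] Module.End k X) (h : ∀ a c x, s c (r a x) = r a (s c x))
    (c : S) (x : X) (y : Y) :
    actLeft r l s h c (tmul r l x y) = tmul r l (s c x) y := by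
  simp [actLeft]

end Balanced

end Balanced

/-! ### Bimodules -/

/-- A `(B, B)`-bimodule on which the field `k` acts centrally, i.e. a `B ⊗ Bᵐᵒᵖ`-module:
`b * m = left b m` and `m * b = right (op b) m`. -/
structure Bimodule (k : Type u) [Field k] (B : Type v) [Ring B] [Algebra k B] where
  carrier : Type w
  [addCommGroup : AddCommGroup carrier]
  [module : Module k carrier]
  left : B →ₐ[k] Module.End k carrier
  right : Bᵐᵒᵖ →ₐ[k] Module.End k carrier
  left_right : ∀ b c m, left b (right c m) = right c (left b m)

namespace Bimodule

variable {k : Type u} [Field k] {B : Type v} [Ring B] [Algebra k B]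

instance : CoeSort (Bimodule.{u, v, w} k B) (Type w) := ⟨Bimodule.carrier⟩

instance (M : Bimodule.{u, v, w} k B) : AddCommGroup M := M.addCommGroup
instance (M : Bimodule.{u, v, w} k B) : Module k M := M.module

/-- A `k`-linear map `f` between bimodules is a bimodule map. -/
def IsBilinear {M N : Bimodule k B} (f : M →ₗ[k] N) : Prop :=
  (∀ b m, f (M.left b m) = N.left b (f m)) ∧ ∀ b m, f (M.right b m) = N.right b (f m)

/-- Isomorphisms of bimodules. -/
structure Iso (M N : Bimodule k B) where
  toEquiv : M ≃ₗ[k] N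
  bilinear : IsBilinear toEquiv.toLinearMap

namespace Iso
variable {M N P : Bimodule k B}

theorem map_left (e : Iso M N) (b : B) (m : M) :
    e.toEquiv (M.left b m) = N.left b (e.toEquiv m) := e.bilinear.1 b m

theorem map_right (e : Iso M N) (b : Bᵐᵒᵖ) (m : M) :
    e.toEquiv (M.right b m) = N.right b (e.toEquiv m) := e.bilinear.2 b m

def refl (M : Bimodule k B) : Iso M M := ⟨.refl k M, fun _ _ => rfl, fun _ _ => rfl⟩

def symm (e : Iso M N) : Iso N M :=
  ⟨e.toEquiv.symm, fun b n => by
    obtain ⟨m, rfl⟩ := e.toEquiv.surjective n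
    simp [← e.map_left], fun b n => by
    obtain ⟨m, rfl⟩ := e.toEquiv.surjective n
    simp [← e.map_right]⟩

def trans (e : Iso M N) (f : Iso N P) : Iso M P :=
  ⟨e.toEquiv.trans f.toEquiv, fun b m => by simp [e.map_left, f.map_left],
    fun b m => by simp [e.map_right, f.map_right]⟩

/-- Mutually inverse bimodule maps form an isomorphism. -/
def ofMaps (f : M →ₗ[k] N) (g : N →ₗ[k] M) (hf : IsBilinear f) (h : f ∘ₗ g = .id)
    (h' : g ∘ₗ f = .id) : Iso M N :=
  ⟨.ofLinearMap f g h h', hf⟩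

end Iso

variable (k B) in
/-- The regular bimodule `B`. -/
def regular : Bimodule.{u, v, v} k B where
  carrier := B
  left := Algebra.lsmul k k B
  right := Algebra.lsmul k k B
  left_right b c m := by simp [mul_assoc]

@[simp] theorem regular_left (b m : B) : (regular k B).left b m = b * m := rfl
@[simp] theorem regular_right (b : Bᵐᵒᵖ) (m : B) : (regular k B).right b m = m * unop b := rfl

/-- The tensor product `M ⊗_B N` of bimodules, with `b (m ⊗ n) c = b m ⊗ n c`. -/
def tensor (M : Bimodule.{u, v, w} k B) (N : Bimodule.{u, v, w'} k B) :
    Bimodule.{u, v, max w w'} k B where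
  carrier := Balanced M.right N.left
  left := Balanced.actLeft M.right N.left M.left fun a c x => M.left_right c a x
  right := Balanced.actRight M.right N.left N.right fun a c y => (N.left_right a c y).symm
  left_right b c z := by
    induction z using Balanced.induction with
    | tmul m n => simp
    | add z z' hz hz' => simp [hz, hz']

/-- The pure tensor `m ⊗_B n`. -/
def tmul (M : Bimodule.{u, v, w} k B) (N : Bimodule.{u, v, w'} k B) (m : M) (n : N) : tensor M N :=
  Balanced.tmul M.right N.left m n

section
variable {M : Bimodule.{u, v, w} k B} {M' : Bimodule.{u, v, w₁} k B}
variable {N : Bimodule.{u, v, w'} k B} {N' : Bimodule.{u, v, w₂} k B} {P : Bimodule.{u, v, w''} k B}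

@[simp] theorem tensor_left (b : B) (m : M) (n : N) :
    (tensor M N).left b (tmul M N m n) = tmul M N (M.left b m) n :=
  Balanced.actLeft_tmul _ (fun a c x => M.left_right c a x) _ _ _

@[simp] theorem tensor_right (b : Bᵐᵒᵖ) (m : M) (n : N) :
    (tensor M N).right b (tmul M N m n) = tmul M N m (N.right b n) :=
  Balanced.actRight_tmul _ (fun a c y => (N.left_right a c y).symm) _ _ _

theorem tmul_act (m : M) (b : B) (n : N) :
    tmul M N (M.right (op b) m) n = tmul M N m (N.left b n) :=
  Balanced.tmul_act _ _ _

variable (M N) in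
/-- `tmul` as a bilinear map. -/
def tmulHom : M →ₗ[k] N →ₗ[k] tensor M N := Balanced.tmulHom M.right N.left

@[simp] theorem tmulHom_apply (m : M) (n : N) : tmulHom M N m n = tmul M N m n := rfl

@[simp] theorem add_tmul (m m' : M) (n : N) : tmul M N (m + m') n = tmul M N m n + tmul M N m' n :=
  Balanced.add_tmul _ _ _

@[simp] theorem tmul_add (m : M) (n n' : N) : tmul M N m (n + n') = tmul M N m n + tmul M N m n' :=
  Balanced.tmul_add _ _ _

@[simp] theorem smul_tmul (c : k) (m : M) (n : N) : tmul M N (c • m) n = c • tmul M N m n :=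
  Balanced.smul_tmul _ _ _

@[simp] theorem tmul_smul (c : k) (m : M) (n : N) : tmul M N m (c • n) = c • tmul M N m n :=
  Balanced.tmul_smul _ _ _

theorem tensor_induction {p : tensor M N → Prop} (tmul : ∀ x y, p (tmul M N x y))
    (add : ∀ z z', p z → p z' → p (z + z')) (z : tensor M N) : p z :=
  Balanced.induction tmul add z

theorem tensor_hom_ext {Z : Type*} [AddCommGroup Z] [Module k Z] {f g : tensor M N →ₗ[k] Z}
    (h : ∀ m n, f (tmul M N m n) = g (tmul M N m n)) : f = g :=
  Balanced.hom_ext h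

/-- The universal property of `M ⊗_B N`. -/
def tensorLift {Z : Type*} [AddCommGroup Z] [Module k Z] (f : M →ₗ[k] N →ₗ[k] Z)
    (hf : ∀ m b n, f (M.right (op b) m) n = f m (N.left b n)) : tensor M N →ₗ[k] Z :=
  Balanced.lift f hf

@[simp] theorem tensorLift_tmul {Z : Type*} [AddCommGroup Z] [Module k Z]
    (f : M →ₗ[k] N →ₗ[k] Z) (hf) (m : M) (n : N) :
    tensorLift f hf (tmul M N m n) = f m n :=
  Balanced.lift_tmul f hf m n

theorem isBilinear_of_tmul {f : tensor M N →ₗ[k] P}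
    (h : ∀ b m n, f (tmul M N (M.left b m) n) = P.left b (f (tmul M N m n)))
    (h' : ∀ b m n, f (tmul M N m (N.right b n)) = P.right b (f (tmul M N m n))) :
    IsBilinear f := by
  refine ⟨fun b z => ?_, fun b z => ?_⟩
  · induction z using tensor_induction with
    | tmul m n => simp [h]
    | add z z' hz hz' => simp [hz, hz']
  · induction z using tensor_induction with
    | tmul m n => simp [h']
    | add z z' hz hz' => simp [hz, hz']

/-- The tensor product `f ⊗_B g` of two bimodule maps. -/
def mapTensor (f : M →ₗ[k] M') (g : N →ₗ[k] N') (hf : IsBilinear f) (hg : IsBilinear g) :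
    tensor M N →ₗ[k] tensor M' N' :=
  tensorLift ((tmulHom M' N').compl₁₂ f g) (by simp [hf.2, hg.1, tmul_act])

@[simp] theorem mapTensor_tmul (f : M →ₗ[k] M') (g : N →ₗ[k] N') (hf) (hg) (m : M) (n : N) :
    mapTensor f g hf hg (tmul M N m n) = tmul M' N' (f m) (g n) := by
  simp [mapTensor]

def Iso.tensorCongr (e : Iso M M') (f : Iso N N') : Iso (tensor M N) (tensor M' N') :=
  .ofMaps (mapTensor _ _ e.bilinear f.bilinear)
    (mapTensor _ _ e.symm.bilinear f.symm.bilinear)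
    (isBilinear_of_tmul (by simp [e.map_left]) (by simp [f.map_right]))
    (tensor_hom_ext (by simp [Iso.symm]))
    (tensor_hom_ext (by simp [Iso.symm]))

variable (M N P) in
/-- Associativity: `(m ⊗ n) ⊗ p ↦ m ⊗ (n ⊗ p)`. -/
def tensorAssoc : Iso (tensor (tensor M N) P) (tensor M (tensor N P)) :=
  .ofMaps
    (tensorLift
      (tensorLift
        { toFun := fun m => (tmulHom N P).compr₂ (tmulHom M (tensor N P) m)
          map_add' := fun m m' => by ext; simp
          map_smul' := fun c m => by ext; simp }
        (fun m b n => by ext p; simp [tmul_act]))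
      (fun z b p => by
        induction z using tensor_induction with
        | tmul m n => simp [tmul_act]
        | add z z' hz hz' => simp [hz, hz']))
    (tensorLift
      (LinearMap.flip (tensorLift
        { toFun := fun n => (tmulHom (tensor M N) P).flip.compl₂ ((tmulHom M N).flip n)
          map_add' := fun m m' => by ext; simp
          map_smul' := fun c m => by ext; simp }
        (fun m b n => by ext p; simp [← tmul_act])))
      (fun m b z => by
        induction z using tensor_induction with
        | tmul m n => simp [tmul_act]
        | add z z' hz hz' => simp_all))
    ⟨fun b z => by
      induction z using tensor_induction with
      | tmul z p =>
        induction z using tensor_induction with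
        | tmul m n => simp
        | add z z' hz hz' => simp_all
      | add z z' hz hz' => simp_all,
     fun b z => by
      induction z using tensor_induction with
      | tmul z p =>
        induction z using tensor_induction with
        | tmul m n => simp
        | add z z' hz hz' => simp_all
      | add z z' hz hz' => simp_all⟩
    (tensor_hom_ext fun m z => by
      induction z using tensor_induction with
      | tmul n p => simp
      | add z z' hz hz' => simp_all)
    (tensor_hom_ext fun z p => by
      induction z using tensor_induction with
      | tmul n p => simp
      | add z z' hz hz' => simp_all)

/-- The left action as a bilinear map on `B × M`. -/
def leftHom (M : Bimodule.{u, v, w} k B) : regular k B →ₗ[k] M →ₗ[k] M := M.left.toLinearMap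

@[simp] theorem leftHom_apply (b : regular k B) (m : M) :
    leftHom M b m = M.left (show B from b) m := rfl

/-- The right action as a bilinear map on `M × B`. -/
def rightHom (M : Bimodule.{u, v, w} k B) : M →ₗ[k] regular k B →ₗ[k] M :=
  LinearMap.flip (M.right.toLinearMap ∘ₗ (opLinearEquiv k : B ≃ₗ[k] Bᵐᵒᵖ).toLinearMap)

@[simp] theorem rightHom_apply (m : M) (b : regular k B) :
    rightHom M m b = M.right (op (show B from b)) m := rfl

theorem left_mul_apply (b c : B) (m : M) : M.left (b * c) m = M.left b (M.left c m) := by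
  simp

theorem right_mul_apply (b c : Bᵐᵒᵖ) (m : M) : M.right (b * c) m = M.right b (M.right c m) := by
  simp

variable (k B) in
/-- The unit of `B`, as an element of the regular bimodule. -/
def unit : regular k B := (1 : B)

theorem leftHom_balanced (c : regular k B) (b : B) (m : M) :
    leftHom M ((regular k B).right (op b) c) m = leftHom M c (M.left b m) :=
  left_mul_apply (M := M) c b m

theorem rightHom_balanced (m : M) (b : B) (c : regular k B) :
    rightHom M (M.right (op b) m) c = rightHom M m ((regular k B).left b c) :=
  (right_mul_apply (M := M) (op c) (op b) m).symm

theorem leftHom_unit (m : M) : leftHom M (unit k B) m = m := congr($(map_one M.left) m)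

theorem rightHom_unit (m : M) : rightHom M m (unit k B) = m := congr($(map_one M.right) m)

theorem right_unit (b : B) : (regular k B).right (op b) (unit k B) = b := one_mul b

theorem left_unit (b : B) : (regular k B).left b (unit k B) = b := mul_one b

variable (M) in
/-- `B ⊗_B M ≅ M`. -/
def leftUnitor : Iso (tensor (regular k B) M) M :=
  .ofMaps (tensorLift (leftHom M) leftHom_balanced)
    (tmulHom (regular k B) M (unit k B))
    (isBilinear_of_tmul (fun b m n => by
        rw [tensorLift_tmul, tensorLift_tmul]; exact left_mul_apply (M := M) b m n)
      (fun b m n => by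
        rw [tensorLift_tmul, tensorLift_tmul]; exact M.left_right m b n))
    (LinearMap.ext fun m => by simp [-leftHom_apply, leftHom_unit])
    (tensor_hom_ext fun b m => by
      simp only [LinearMap.comp_apply, tensorLift_tmul, tmulHom_apply, LinearMap.id_apply]
      rw [leftHom_apply, ← tmul_act, right_unit])

variable (M) in
/-- `M ⊗_B B ≅ M`. -/
def rightUnitor : Iso (tensor M (regular k B)) M :=
  .ofMaps (tensorLift (rightHom M) rightHom_balanced)
    ((tmulHom M (regular k B)).flip (unit k B))
    (isBilinear_of_tmul (fun b m c => by
        rw [tensorLift_tmul, tensorLift_tmul]; exact (M.left_right b (op c) m).symm)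
      (fun b m c => by
        rw [tensorLift_tmul, tensorLift_tmul]; exact right_mul_apply (M := M) b (op c) m))
    (LinearMap.ext fun m => by simp [-rightHom_apply, rightHom_unit])
    (tensor_hom_ext fun m b => by
      simp only [LinearMap.comp_apply, tensorLift_tmul, tmulHom_apply, LinearMap.flip_apply,
        LinearMap.id_apply]
      rw [rightHom_apply, tmul_act, left_unit])
end

end Bimodule

/-! ### The Picard group -/

section Picard

variable (k : Type u) [Field k] (B : Type v) [Ring B] [Algebra k B]

instance bimodSetoid : Setoid (Bimodule.{u, v, v} k B) where
  r M N := Nonempty (M.Iso N)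
  iseqv := ⟨fun M => ⟨.refl M⟩, fun ⟨e⟩ => ⟨e.symm⟩, fun ⟨e⟩ ⟨f⟩ => ⟨e.trans f⟩⟩

/-- Isomorphism classes of `(B, B)`-bimodules. -/
def BimodClass : Type _ := Quotient (bimodSetoid.{u, v} k B)

variable {k B} in
/-- The isomorphism class of a bimodule. -/
def BimodClass.mk (M : Bimodule.{u, v, v} k B) : BimodClass k B := Quotient.mk _ M

/-- Isomorphism classes of bimodules form a monoid under `⊗_B`, with unit `B`. -/
instance : Monoid (BimodClass k B) where
  mul := Quotient.map₂ Bimodule.tensor fun _ _ ⟨e⟩ _ _ ⟨f⟩ => ⟨e.tensorCongr f⟩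
  one := Quotient.mk _ (Bimodule.regular k B)
  mul_assoc := by
    rintro ⟨M⟩ ⟨N⟩ ⟨P⟩
    exact Quotient.sound ⟨Bimodule.tensorAssoc M N P⟩
  one_mul := by
    rintro ⟨M⟩
    exact Quotient.sound ⟨Bimodule.leftUnitor M⟩
  mul_one := by
    rintro ⟨M⟩
    exact Quotient.sound ⟨Bimodule.rightUnitor M⟩

/-- The Picard group of `B`: isomorphism classes of invertible bimodules. -/
abbrev Pic : Type _ := (BimodClass k B)ˣ

/-- A strict Morita context `(B, B, M, N, α, β)`. -/
structure MoritaContext where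
  M : Bimodule.{u, v, v} k B
  N : Bimodule.{u, v, v} k B
  α : (M.tensor N).Iso (Bimodule.regular k B)
  β : (N.tensor M).Iso (Bimodule.regular k B)
  assoc_left : ∀ (m : M) (n : N) (m' : M),
    M.left (α.toEquiv (M.tmul N m n)) m' = M.right (op (β.toEquiv (N.tmul M n m'))) m
  assoc_right : ∀ (n : N) (m : M) (n' : N),
    N.left (β.toEquiv (N.tmul M n m)) n' = N.right (op (α.toEquiv (M.tmul N m n'))) n

variable {k B} in
/-- The class in `Pic B` of a strict Morita context. It only depends on the bimodule `M`. -/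
def MoritaContext.toPic (C : MoritaContext k B) : Pic k B where
  val := .mk C.M
  inv := .mk C.N
  val_inv := Quotient.sound ⟨C.α⟩
  inv_val := Quotient.sound ⟨C.β⟩

end Picard

/-! ### Hopf-Galois extensions -/

section Antipode

open Coalgebra HopfAlgebra WithConv

variable (k : Type*) (H : Type*) [Field k] [Ring H] [HopfAlgebra k H] [IsCocomm k H]

theorem antipode_antipode (h : H) : antipode k (antipode k h) = h := by
  have key : toConv (antipode k ∘ₗ antipode k) * toConv (antipode k (A := H)) = 1 := by
    ext h
    have e : (LinearMap.mul' k H ∘ₗ (antipode k).lTensor H) (comul (R := k) h)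
        = algebraMap k H (counit h) := by simp
    rw [← comm_comul k h] at e
    have e' := congrArg (antipode k) e
    rw [Algebra.algebraMap_eq_smul_one, map_smul, antipode_one,
      ← Algebra.algebraMap_eq_smul_one] at e'
    rw [LinearMap.convMul_apply, LinearMap.convOne_apply, ← e']
    generalize comul (R := k) h = z
    induction z with
    | zero => simp
    | tmul a b => simp [antipode_mul_antidistrib]
    | add a b ha hb => simp only [map_add, ha, hb]
  have h1 := left_inv_eq_right_inv key (LinearMap.antipode_mul_id (R := k) (C := H))
  exact congr($(congrArg ofConv h1) h)

/-- The antipode of a cocommutative Hopf algebra, as a bijection. -/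
def antipodeEquiv : H ≃ₗ[k] H :=
  .ofLinearMap (antipode k) (antipode k) (LinearMap.ext (antipode_antipode k H))
    (LinearMap.ext (antipode_antipode k H))

@[simp] theorem antipodeEquiv_apply (h : H) : antipodeEquiv k H h = antipode k h := rfl
@[simp] theorem antipodeEquiv_symm_apply (h : H) :
    (antipodeEquiv k H).symm h = antipode k h := rfl

theorem comul_antipode (h : H) :
    comul (R := k) (antipode k h) = TensorProduct.map (antipode k) (antipode k) (comul h) := by
  have h1 : toConv (TensorProduct.map (antipode k) (antipode k) ∘ₗ comul) *
      toConv (comul (R := k) (A := H)) = 1 := by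
    have := LinearMap.convMul_comp_coalgHom_distrib (toConv (antipode k (A := H ⊗[k] H)))
      (toConv LinearMap.id) (comulCoalgHom k H)
    rw [LinearMap.antipode_mul_id] at this
    refine (congrArg toConv this.symm).trans ?_
    ext h
    simp
  have h2 := left_inv_eq_right_inv h1 (LinearMap.comul_right_inv (R := k) (C := H))
  exact congr($(congrArg ofConv h2) h).symm

end Antipode
section Galois

open Coalgebra HopfAlgebra

/-- `A` is a right `H`-comodule algebra, with coaction `coact : a ↦ a₀ ⊗ a₁`. -/
class ComoduleAlgebra (k : Type*) (H : Type*) (A : Type*) [Field k] [Ring H] [Bialgebra k H]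
    [Ring A] [Algebra k A] where
  coact : A →ₐ[k] A ⊗[k] H
  coact_coassoc : ∀ a, TensorProduct.assoc k A H H (coact.toLinearMap.rTensor H (coact a)) =
    (comul (R := k) (A := H)).lTensor A (coact a)
  coact_counit : ∀ a, TensorProduct.rid k A ((counit (R := k) (A := H)).lTensor A (coact a)) = a

open ComoduleAlgebra

variable (k : Type u) (H : Type w) (A : Type v) [Field k] [Ring H] [HopfAlgebra k H]
variable [Ring A] [Algebra k A] [ComoduleAlgebra k H A]

/-- The subalgebra `B` of coinvariants: all `b` with `b₀ ⊗ b₁ = b ⊗ 1`. -/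
def coinv : Subalgebra k A :=
  AlgHom.equalizer (coact (k := k) (H := H)) Algebra.TensorProduct.includeLeft

theorem mem_coinv {b : A} : b ∈ coinv k H A ↔ coact (k := k) (H := H) b = b ⊗ₜ 1 := Iff.rfl

/-- `A` as a bimodule over the coinvariants `B`. -/
def ambient : Bimodule.{u, v, v} k (coinv k H A) where
  carrier := A
  left := (Algebra.lsmul k k A : A →ₐ[k] Module.End k A).comp (coinv k H A).val
  right := (Algebra.lsmul k k A : Aᵐᵒᵖ →ₐ[k] Module.End k A).comp (AlgHom.op (coinv k H A).val)
  left_right b c m := by simp [mul_assoc]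

/-- `A ⊗_B A` -/
abbrev TensorSq := (ambient k H A).tensor (ambient k H A)

variable {k A} in
/-- The pure tensor `a ⊗_B a'` in `A ⊗_B A`. -/
def tmulA (a a' : A) : TensorSq k H A := (ambient k H A).tmul (ambient k H A) a a'

/-- The canonical map `A ⊗_B A → A ⊗ H`, `a ⊗ a' ↦ a a'₀ ⊗ a'₁`. -/
def can : TensorSq k H A →ₗ[k] A ⊗[k] H :=
  Bimodule.tensorLift (M := ambient k H A) (N := ambient k H A)
    ((LinearMap.mul k (A ⊗[k] H)).compl₁₂
      (Algebra.TensorProduct.includeLeft (R := k) (S := k) (A := A) (B := H)).toLinearMap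
      (coact (k := k) (H := H) (A := A)).toLinearMap)
    (by
      intro (a : A) (b : coinv k H A) (a' : A)
      have hb : coact (k := k) (H := H) (b : A) = (b : A) ⊗ₜ 1 := b.2
      change ((a * (b : A) : A) ⊗ₜ[k] (1 : H)) * coact (k := k) (H := H) a' =
        (a ⊗ₜ[k] (1 : H)) * coact (k := k) (H := H) ((b : A) * a')
      rw [map_mul, hb, ← mul_assoc]
      simp)

theorem can_tmul (a a' : A) :
    can k H A (tmulA H a a') = (a ⊗ₜ 1) * coact (k := k) (H := H) a' :=
  Bimodule.tensorLift_tmul (M := ambient k H A) (N := ambient k H A) _ _ a a'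

/-- A left module `Y` over the `k`-algebra `R`, given by `l : R → End Y`, is faithfully flat:
`X ↦ X ⊗_R Y` preserves injections of right `R`-modules and does not kill nonzero modules. -/
structure IsFaithfullyFlat {k : Type u} [Field k] {R : Type v} [Ring R] [Algebra k R]
    {Y : Type w} [AddCommGroup Y] [Module k Y] (l : R →ₐ[k] Module.End k Y) : Prop where
  flat : ∀ (X X' : Type v) [AddCommGroup X] [Module k X] [AddCommGroup X'] [Module k X']
    (r : Rᵐᵒᵖ →ₐ[k] Module.End k X) (r' : Rᵐᵒᵖ →ₐ[k] Module.End k X') (f : X →ₗ[k] X')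
    (hf : ∀ a x, f (r a x) = r' a (f x)), Function.Injective f →
      Function.Injective (Balanced.map (r := r) (l := l) (r' := r') (l' := l)
        f LinearMap.id hf (fun _ _ => rfl))
  faithful : ∀ (X : Type v) [AddCommGroup X] [Module k X] (r : Rᵐᵒᵖ →ₐ[k] Module.End k X),
    Subsingleton (Balanced r l) → Subsingleton X

/-- `A` is a faithfully flat `H`-Galois extension of its coinvariants `B`: the canonical map is
bijective and `A` is faithfully flat as a left `B`-module. -/
structure IsFaithfullyFlatGalois : Prop where
  can_bijective : Function.Bijective (can k H A)
  faithfullyFlat : IsFaithfullyFlat (ambient k H A).left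

variable {k H A}

/-- The map `γ : H → A ⊗_B A`, `γ(h) = can⁻¹(1 ⊗ h) = ∑ lᵢ(h) ⊗ rᵢ(h)`. -/
def translation (hA : IsFaithfullyFlatGalois k H A) : H →ₗ[k] TensorSq k H A :=
  (LinearEquiv.ofBijective (can k H A) hA.can_bijective).symm.toLinearMap ∘ₗ
    TensorProduct.mk k A H 1

theorem can_translation (hA : IsFaithfullyFlatGalois k H A) (h : H) :
    can k H A (translation hA h) = 1 ⊗ₜ h :=
  (LinearEquiv.ofBijective (can k H A) hA.can_bijective).apply_symm_apply _

/-- For central `x` in `B`, the map `A ⊗_B A → A`, `a ⊗ a' ↦ a x a'`. -/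
def sandwich (x : Subalgebra.center k (coinv k H A)) : TensorSq k H A →ₗ[k] A :=
  Bimodule.tensorLift (M := ambient k H A) (N := ambient k H A)
    ((LinearMap.mul k A).compl₁₂ (LinearMap.mulRight k (x : A)) LinearMap.id)
    (by
      intro (a : A) (b : coinv k H A) (a' : A)
      have hx : (b : A) * (x : A) = x * b :=
        congrArg Subtype.val (Subalgebra.mem_center_iff.1 x.2 b)
      change a * (b : A) * (x : A) * a' = a * (x : A) * ((b : A) * a')
      rw [mul_assoc a, hx]
      simp only [mul_assoc])

theorem sandwich_tmul (x : Subalgebra.center k (coinv k H A)) (a a' : A) :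
    sandwich x (tmulA H a a') = a * x * a' :=
  Bimodule.tensorLift_tmul (M := ambient k H A) (N := ambient k H A) _ _ a a'

/-- The Miyashita-Ulbrich action `x • h = ∑ lᵢ(h) x rᵢ(h)` (with values in `A`). -/
def mu (hA : IsFaithfullyFlatGalois k H A) (x : Subalgebra.center k (coinv k H A)) : H →ₗ[k] A :=
  sandwich x ∘ₗ translation hA

section Facts

variable {E : Type*} [Ring E] [Algebra k E]

/-- `a ⊗ h ↦ ι(a) F(h)` -/
def ev (ι : A →ₐ[k] E) (F : H →ₗ[k] E) : A ⊗[k] H →ₗ[k] E :=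
  LinearMap.mul' k E ∘ₗ TensorProduct.map ι.toLinearMap F

@[simp] theorem ev_tmul (ι : A →ₐ[k] E) (F : H →ₗ[k] E) (a : A) (h : H) :
    ev ι F (a ⊗ₜ h) = ι a * F h := rfl

theorem ev_mul_left (ι : A →ₐ[k] E) (F : H →ₗ[k] E) (a : A) (z : A ⊗[k] H) :
    ev ι F ((a ⊗ₜ 1) * z) = ι a * ev ι F z := by
  induction z with
  | zero => simp
  | tmul a' h => simp [mul_assoc]
  | add z z' hz hz' => rw [mul_add, map_add, hz, hz', map_add, mul_add]

theorem tensorSq_induction {p : TensorSq k H A → Prop} (tmul : ∀ a a', p (tmulA H a a'))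
    (add : ∀ z z', p z → p z' → p (z + z')) (z : TensorSq k H A) : p z :=
  Bimodule.tensor_induction tmul add z

theorem galois_ext (hA : IsFaithfullyFlatGalois k H A) (ι : A →ₐ[k] E) {F G : H →ₗ[k] E}
    (h : ∀ a, ev ι F (coact a) = ev ι G (coact a)) : F = G := by
  have key : ∀ z, ev ι F (can k H A z) = ev ι G (can k H A z) := by
    intro z
    induction z using tensorSq_induction with
    | tmul a a' => rw [can_tmul, ev_mul_left, ev_mul_left, h]
    | add z z' hz hz' => rw [map_add, map_add, map_add, hz, hz']
  ext x
  simpa [can_translation] using key (translation hA x)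

variable (hA : IsFaithfullyFlatGalois k H A)

variable (k H) in
/-- Multiplication by `a` from the left on `A ⊗_B A`. -/
def mulTensorSq (a : A) : TensorSq k H A →ₗ[k] TensorSq k H A :=
  Balanced.map (LinearMap.mulLeft k a) LinearMap.id
    (fun b (x : A) => (mul_assoc a x (unop b : coinv k H A)).symm) (fun _ _ => rfl)

theorem mulTensorSq_tmul (a c c' : A) :
    mulTensorSq k H a (tmulA H c c') = tmulA H (a * c) c' :=
  Balanced.map_tmul _ _ _ _ _ _

theorem ev_mu_can (x : Subalgebra.center k (coinv k H A)) (z : TensorSq k H A) :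
    ev (AlgHom.id k A) (mu hA x) (can k H A z) = sandwich x z := by
  have h1 : ∀ (a : A) (z : TensorSq k H A), can k H A (mulTensorSq k H a z) = (a ⊗ₜ 1) * can k H A z := by
    intro a z
    induction z using tensorSq_induction with
    | tmul c c' => rw [mulTensorSq_tmul, can_tmul, can_tmul, ← mul_assoc]; simp
    | add z z' hz hz' => rw [map_add, map_add, map_add, mul_add, hz, hz']
  have h2 : ∀ (a : A) (z : TensorSq k H A), sandwich x (mulTensorSq k H a z) = a * sandwich x z := by
    intro a z
    induction z using tensorSq_induction with
    | tmul c c' => rw [mulTensorSq_tmul, sandwich_tmul, sandwich_tmul]; simp only [mul_assoc]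
    | add z z' hz hz' => rw [map_add, map_add, map_add, mul_add, hz, hz']
  have h3 : ∀ t : A ⊗[k] H, ∃ z, can k H A z = t ∧ ev (AlgHom.id k A) (mu hA x) t = sandwich x z := by
    intro t
    induction t with
    | zero => exact ⟨0, by simp, by simp⟩
    | tmul a h =>
      refine ⟨mulTensorSq k H a (translation hA h), ?_, ?_⟩
      · rw [h1, can_translation]; simp
      · rw [h2]; rfl
    | add t t' ht ht' =>
      obtain ⟨z, hz, hz'⟩ := ht
      obtain ⟨y, hy, hy'⟩ := ht'
      exact ⟨z + y, by rw [map_add, hz, hy], by rw [map_add, map_add, hz', hy']⟩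
  obtain ⟨z', h4, h5⟩ := h3 (can k H A z)
  rw [h5, hA.can_bijective.1 h4]

theorem ev_mu (x : Subalgebra.center k (coinv k H A)) (a : A) :
    ev (AlgHom.id k A) (mu hA x) (coact a) = x * a := by
  have h := ev_mu_can hA x (tmulA H 1 a)
  rwa [can_tmul, sandwich_tmul, one_mul, ← Algebra.TensorProduct.one_def, one_mul] at h

theorem mu_unique (x : Subalgebra.center k (coinv k H A)) (F : H →ₗ[k] A)
    (h : ∀ a, ev (AlgHom.id k A) F (coact a) = x * a) : mu hA x = F :=
  galois_ext hA (AlgHom.id k A) fun a => by rw [ev_mu, h]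

theorem mu_commute (x : Subalgebra.center k (coinv k H A)) (h : H) (b : coinv k H A) :
    b * mu hA x h = mu hA x h * b := by
  have : LinearMap.mulLeft k (b : A) ∘ₗ mu hA x = LinearMap.mulRight k (b : A) ∘ₗ mu hA x := by
    refine galois_ext hA (AlgHom.id k A) fun a => ?_
    have h1 : ∀ z : A ⊗[k] H, ev (AlgHom.id k A) (LinearMap.mulRight k (b : A) ∘ₗ mu hA x) z =
        ev (AlgHom.id k A) (mu hA x) z * b := by
      intro z
      induction z with
      | zero => simp
      | tmul a h => simp [mul_assoc]
      | add z z' hz hz' => simp [hz, hz', add_mul]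
    have h2 : ∀ z : A ⊗[k] H, ev (AlgHom.id k A) (LinearMap.mulLeft k (b : A) ∘ₗ mu hA x) z =
        ev (AlgHom.id k A) (mu hA x) (z * ((b : A) ⊗ₜ 1)) := by
      intro z
      induction z with
      | zero => simp
      | tmul a h => simp [mul_assoc]
      | add z z' hz hz' => simp [hz, hz', add_mul]
    rw [h1, h2, ev_mu, ← (mem_coinv k H A).1 b.2, ← map_mul, ev_mu, mul_assoc]
  exact congr($this h)

theorem mu_mem_coinv [IsCocomm k H] (x : Subalgebra.center k (coinv k H A)) (h : H) :
    mu hA x h ∈ coinv k H A := by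
  have : (coact (k := k) (H := H) (A := A)).toLinearMap ∘ₗ mu hA x =
      (Algebra.TensorProduct.includeLeft (R := k) (S := k) (A := A) (B := H)).toLinearMap ∘ₗ
        mu hA x := by
    refine galois_ext hA (coact (k := k) (H := H)) fun a => ?_
    have h1 : ∀ z : A ⊗[k] H, ev (coact (k := k) (H := H) (A := A))
        ((coact (k := k) (H := H) (A := A)).toLinearMap ∘ₗ mu hA x) z =
        coact (ev (AlgHom.id k A) (mu hA x) z) := by
      intro z
      induction z with
      | zero => simp
      | tmul a h => simp
      | add z z' hz hz' => simp [hz, hz']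
    -- `a ⊗ (h ⊗ h') ↦ a (x • h) ⊗ h'`
    let Θ : A ⊗[k] (H ⊗[k] H) →ₗ[k] A ⊗[k] H :=
      (ev (AlgHom.id k A) (mu hA x)).rTensor H ∘ₗ (TensorProduct.assoc k A H H).symm.toLinearMap
    have h2 : ∀ z : A ⊗[k] H, ev (coact (k := k) (H := H) (A := A))
        ((Algebra.TensorProduct.includeLeft (R := k) (S := k) (A := A) (B := H)).toLinearMap ∘ₗ
          mu hA x) z =
        Θ ((TensorProduct.comm k H H).toLinearMap.lTensor A
          (TensorProduct.assoc k A H H (coact.toLinearMap.rTensor H z))) := by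
      intro z
      induction z with
      | zero => simp
      | tmul a h =>
        simp only [ev_tmul, LinearMap.rTensor_tmul, AlgHom.toLinearMap_apply, LinearMap.comp_apply]
        generalize coact (k := k) (H := H) a = y
        induction y with
        | zero => simp
        | tmul c g => simp [Θ]
        | add y y' hy hy' => simp only [add_mul, hy, hy', TensorProduct.add_tmul, map_add]
      | add z z' hz hz' => simp only [hz, hz', map_add]
    have h3 : ∀ z : A ⊗[k] H, (ev (AlgHom.id k A) (mu hA x)).rTensor H
        (coact.toLinearMap.rTensor H z) = ((x : A) ⊗ₜ 1) * z := by
      intro z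
      induction z with
      | zero => simp
      | tmul a h => simp [ev_mu]
      | add z z' hz hz' => simp only [map_add, hz, hz', mul_add]
    rw [h1, h2, ev_mu, coact_coassoc, ← LinearMap.lTensor_comp_apply, comm_comp_comul,
      ← coact_coassoc, map_mul, (mem_coinv k H A).1 x.1.2]
    simp only [Θ, LinearMap.comp_apply, LinearEquiv.coe_coe, LinearEquiv.symm_apply_apply, h3]
  exact congr($this h)

/-- The right Miyashita-Ulbrich action of `H` on `Z(B)`. -/
def muRight [IsCocomm k H] (x : Subalgebra.center k (coinv k H A)) (h : H) :
    Subalgebra.center k (coinv k H A) :=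
  ⟨⟨mu hA x h, mu_mem_coinv hA x h⟩, Subalgebra.mem_center_iff.2 fun b =>
    Subtype.ext (mu_commute hA x h b)⟩

@[simp] theorem coe_muRight [IsCocomm k H] (x : Subalgebra.center k (coinv k H A)) (h : H) :
    ((muRight hA x h : coinv k H A) : A) = mu hA x h := rfl

theorem mu_one_right (x : Subalgebra.center k (coinv k H A)) : mu hA x 1 = x := by
  have h := ev_mu hA x 1
  rw [map_one, Algebra.TensorProduct.one_def] at h
  simpa using h

theorem mu_add (x y : Subalgebra.center k (coinv k H A)) : mu hA (x + y) = mu hA x + mu hA y := by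
  refine mu_unique hA _ _ fun a => ?_
  have : ∀ z, ev (AlgHom.id k A) (mu hA x + mu hA y) z =
      ev (AlgHom.id k A) (mu hA x) z + ev (AlgHom.id k A) (mu hA y) z := by
    intro z; simp [ev, TensorProduct.map_add_right]
  rw [this, ev_mu, ev_mu]
  simp [add_mul]

theorem mu_smul (c : k) (x : Subalgebra.center k (coinv k H A)) :
    mu hA (c • x) = c • mu hA x := by
  refine mu_unique hA _ _ fun a => ?_
  have : ∀ z, ev (AlgHom.id k A) (c • mu hA x) z = c • ev (AlgHom.id k A) (mu hA x) z := by
    intro z; simp [ev, TensorProduct.map_smul_right]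
  rw [this, ev_mu]
  simp

theorem mu_one_left (h : H) : mu hA 1 h = algebraMap k A (counit h) := by
  have : mu hA 1 = Algebra.linearMap k A ∘ₗ counit := by
    refine mu_unique hA _ _ fun a => ?_
    have h1 : ∀ z : A ⊗[k] H, ev (AlgHom.id k A) (Algebra.linearMap k A ∘ₗ counit) z =
        TensorProduct.rid k A ((counit (R := k) (A := H)).lTensor A z) := by
      intro z
      induction z with
      | zero => simp
      | tmul a h => simp [Algebra.smul_def, Algebra.commutes]
      | add z z' hz hz' => simp only [map_add, hz, hz']
    rw [h1, coact_counit]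
    simp
  rw [this]; rfl

theorem mu_mul_left (x y : Subalgebra.center k (coinv k H A)) (h : H) :
    mu hA (x * y) h = LinearMap.mul' k A (TensorProduct.map (mu hA x) (mu hA y) (comul h)) := by
  have : mu hA (x * y) = LinearMap.mul' k A ∘ₗ TensorProduct.map (mu hA x) (mu hA y) ∘ₗ comul := by
    refine mu_unique hA _ _ fun a => ?_
    have h1 : ∀ z : A ⊗[k] H, ev (AlgHom.id k A)
        (LinearMap.mul' k A ∘ₗ TensorProduct.map (mu hA x) (mu hA y) ∘ₗ comul) z =
        ev (AlgHom.id k A) (mu hA y) ((ev (AlgHom.id k A) (mu hA x)).rTensor H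
          ((TensorProduct.assoc k A H H).symm ((comul (R := k) (A := H)).lTensor A z))) := by
      intro z
      induction z with
      | zero => simp
      | tmul a h =>
        simp only [ev_tmul, LinearMap.comp_apply, LinearMap.lTensor_tmul]
        generalize comul (R := k) h = y
        induction y with
        | zero => simp
        | tmul c g => simp [mul_assoc]
        | add y y' hy hy' => simp only [mul_add, hy, hy', TensorProduct.tmul_add, map_add]
      | add z z' hz hz' => simp only [map_add, hz, hz']
    have h3 : ∀ z : A ⊗[k] H, (ev (AlgHom.id k A) (mu hA x)).rTensor H
        (coact.toLinearMap.rTensor H z) = ((x : A) ⊗ₜ 1) * z := by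
      intro z
      induction z with
      | zero => simp
      | tmul a h => simp [ev_mu]
      | add z z' hz hz' => simp only [map_add, hz, hz', mul_add]
    rw [h1, ← coact_coassoc, LinearEquiv.symm_apply_apply, h3, ev_mul_left, ev_mu]
    simp [mul_assoc]
  exact congr($this h)

theorem mu_mul_right [IsCocomm k H] (x : Subalgebra.center k (coinv k H A)) (h h' : H) :
    mu hA x (h * h') = mu hA (muRight hA x h) h' := by
  have key : mu hA (muRight hA x h) = mu hA x ∘ₗ LinearMap.mulLeft k h := by
    refine mu_unique hA _ _ fun a' => ?_
    rw [coe_muRight]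
    -- both sides are linear in `h`
    let F : H →ₗ[k] A :=
      { toFun := fun h => ev (AlgHom.id k A) (mu hA x ∘ₗ LinearMap.mulLeft k h) (coact a')
        map_add' := fun g g' => by
          have : mu hA x ∘ₗ LinearMap.mulLeft k (g + g') =
            mu hA x ∘ₗ LinearMap.mulLeft k g + mu hA x ∘ₗ LinearMap.mulLeft k g' := by
            ext; simp [add_mul]
          simp [this, ev, TensorProduct.map_add_right]
        map_smul' := fun c g => by
          have : mu hA x ∘ₗ LinearMap.mulLeft k (c • g) =
            c • (mu hA x ∘ₗ LinearMap.mulLeft k g) := by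
            ext; simp
          simp [this, ev, TensorProduct.map_smul_right] }
    have hF : ∀ h, F h = ev (AlgHom.id k A) (mu hA x ∘ₗ LinearMap.mulLeft k h) (coact a') :=
      fun _ => rfl
    have : F = LinearMap.mulRight k a' ∘ₗ mu hA x := by
      refine galois_ext hA (AlgHom.id k A) fun a => ?_
      have h1 : ∀ z : A ⊗[k] H, ev (AlgHom.id k A) (LinearMap.mulRight k a' ∘ₗ mu hA x) z =
          ev (AlgHom.id k A) (mu hA x) z * a' := by
        intro z
        induction z with
        | zero => simp
        | tmul a h => simp [mul_assoc]
        | add z z' hz hz' => simp [hz, hz', add_mul]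
      have h2 : ∀ z : A ⊗[k] H, ev (AlgHom.id k A) F z =
          ev (AlgHom.id k A) (mu hA x) (z * coact a') := by
        intro z
        induction z with
        | zero => simp
        | tmul a h =>
          rw [ev_tmul, hF]
          generalize coact (k := k) (H := H) a' = y
          induction y with
          | zero => simp
          | tmul c g => simp [mul_assoc]
          | add y y' hy hy' => simp only [mul_add, hy, hy', map_add]
        | add z z' hz hz' => simp [hz, hz', add_mul]
      rw [h1, h2, ← map_mul, ev_mu, ev_mu, mul_assoc]
    exact congr($this h)
  rw [key]; rfl

end Facts

/-- A left `H`-module algebra structure on the commutative algebra `R`, with action `h · x = act h x`. -/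
structure ModuleAlgebra (k : Type*) (H : Type*) (R : Type*) [Field k] [Ring H] [Bialgebra k H]
    [CommRing R] [Algebra k R] where
  act : H →ₗ[k] R →ₗ[k] R
  one_act : ∀ x, act 1 x = x
  mul_act : ∀ h h' x, act (h * h') x = act h (act h' x)
  act_one : ∀ h, act h 1 = algebraMap k R (counit h)
  act_mul : ∀ h x y, act h (x * y) =
    LinearMap.mul' k R (TensorProduct.map (act.flip x) (act.flip y) (comul h))

/-- The left `H`-module algebra structure on `Z(B)` given by the Miyashita-Ulbrich action
`h · x = x • S⁻¹(h) = ∑ lᵢ(S⁻¹(h)) x rᵢ(S⁻¹(h))`. -/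
def centerModuleAlgebra [IsCocomm k H] (hA : IsFaithfullyFlatGalois k H A) :
    ModuleAlgebra k H (Subalgebra.center k (coinv k H A)) where
  act := LinearMap.mk₂ k (fun h x => muRight hA x ((antipodeEquiv k H).symm h))
    (fun h h' x => Subtype.ext <| Subtype.ext <| by simp)
    (fun c h x => Subtype.ext <| Subtype.ext <| by simp)
    (fun h x y => Subtype.ext <| Subtype.ext <| by simp [mu_add])
    (fun c h x => Subtype.ext <| Subtype.ext <| by simp [mu_smul])
  one_act x := Subtype.ext <| Subtype.ext <| by simp [mu_one_right]
  mul_act h h' x := Subtype.ext <| Subtype.ext <| by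
    simp [antipode_mul_antidistrib, mu_mul_right]
  act_one h := Subtype.ext <| Subtype.ext <| by simp [mu_one_left]
  act_mul h x y := Subtype.ext <| Subtype.ext <| by
    simp only [LinearMap.mk₂_apply, coe_muRight, antipodeEquiv_symm_apply, mu_mul_left,
      comul_antipode]
    generalize comul (R := k) h = z
    induction z with
    | zero => simp
    | tmul g g' => simp
    | add z z' hz hz' => simp only [map_add, hz, hz']; simp

variable (k H A) in
/-- The center `Z(B)` of the algebra `B` of coinvariants. -/
def CenterB : Type v := Subalgebra.center k (coinv k H A)

instance : CommRing (CenterB k H A) :=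
  inferInstanceAs (CommRing (Subalgebra.center k (coinv k H A)))
instance : Algebra k (CenterB k H A) :=
  inferInstanceAs (Algebra k (Subalgebra.center k (coinv k H A)))

/-- The inclusion of `Z(B)` in `B`. -/
def CenterB.val : CenterB k H A →ₐ[k] coinv k H A := (Subalgebra.center k (coinv k H A)).val

/-- The left `H`-module algebra structure on `Z(B)` given by the Miyashita-Ulbrich action. -/
def miyashitaUlbrich [IsCocomm k H] (hA : IsFaithfullyFlatGalois k H A) :
    ModuleAlgebra k H (CenterB k H A) :=
  centerModuleAlgebra hA

end Galois

/-! ### Enveloping algebras and cotensor products -/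

section Env

variable {k : Type u} [Field k] {B : Type v} [Ring B] [Algebra k B]

/-- A bimodule as a left module over the enveloping algebra `B ⊗ Bᵐᵒᵖ`:
`(b ⊗ c) * m = b * m * c`. -/
def Bimodule.env (M : Bimodule.{u, v, w} k B) : B ⊗[k] Bᵐᵒᵖ →ₐ[k] Module.End k M :=
  Algebra.TensorProduct.lift M.left M.right fun b c =>
    show Commute (M.left b) (M.right c) from LinearMap.ext (M.left_right b c)

@[simp] theorem Bimodule.env_tmul (M : Bimodule.{u, v, w} k B) (b : B) (c : Bᵐᵒᵖ) (m : M) :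
    M.env (b ⊗ₜ c) m = M.left b (M.right c m) := by
  rw [env, Algebra.TensorProduct.lift_tmul]; rfl

/-- A left module over the enveloping algebra `B ⊗ Bᵐᵒᵖ` as a bimodule. -/
def Bimodule.ofEnv {X : Type w} [AddCommGroup X] [Module k X]
    (l : B ⊗[k] Bᵐᵒᵖ →ₐ[k] Module.End k X) : Bimodule.{u, v, w} k B where
  carrier := X
  left := l.comp Algebra.TensorProduct.includeLeft
  right := l.comp Algebra.TensorProduct.includeRight
  left_right b c m := by
    simp [← Module.End.mul_apply, ← map_mul]

end Env

section Cotensor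

open Coalgebra HopfAlgebra ComoduleAlgebra

variable (k : Type u) (H : Type w) (A : Type v) (A' : Type v) [Field k] [Ring H] [HopfAlgebra k H]
variable [Ring A] [Algebra k A] [ComoduleAlgebra k H A]
variable [Ring A'] [Algebra k A'] [ComoduleAlgebra k H A']

/-- `a ⊗ a' ↦ a₀ ⊗ a' ⊗ a₁` -/
def coactL : A ⊗[k] A' →ₐ[k] (A ⊗[k] A') ⊗[k] H :=
  (Algebra.TensorProduct.assoc k k k A A' H).symm.toAlgHom.comp <|
    (Algebra.TensorProduct.map (.id k A) (Algebra.TensorProduct.comm k H A').toAlgHom).comp <|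
      (Algebra.TensorProduct.assoc k k k A H A').toAlgHom.comp <|
        Algebra.TensorProduct.map coact (.id k A')

/-- `a ⊗ a' ↦ a ⊗ a'₀ ⊗ a'₁` -/
def coactR : A ⊗[k] A' →ₐ[k] (A ⊗[k] A') ⊗[k] H :=
  (Algebra.TensorProduct.assoc k k k A A' H).symm.toAlgHom.comp <|
    Algebra.TensorProduct.map (.id k A) coact

/-- The cotensor product `A □ A'`: the subalgebra of all `∑ aᵢ ⊗ a'ᵢ` in `A ⊗ A'` with
`∑ aᵢ₀ ⊗ a'ᵢ ⊗ aᵢ₁ = ∑ aᵢ ⊗ a'ᵢ₀ ⊗ a'ᵢ₁`. -/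
def cotensor : Subalgebra k (A ⊗[k] A') := AlgHom.equalizer (coactL k H A A') (coactR k H A A')

variable {k H A A'}

theorem mem_cotensor {t : A ⊗[k] A'} :
    t ∈ cotensor k H A A' ↔ coactL k H A A' t = coactR k H A A' t := Iff.rfl

theorem coactL_coassoc (t : A ⊗[k] A') :
    TensorProduct.assoc k _ H H ((coactL k H A A').toLinearMap.rTensor H (coactL k H A A' t)) =
      (comul (R := k) (A := H)).lTensor _ (coactL k H A A' t) := by
  let σ (X : Type _) [AddCommGroup X] [Module k X] : (A ⊗[k] X) ⊗[k] A' →ₗ[k] (A ⊗[k] A') ⊗[k] X :=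
    (TensorProduct.rightComm k A X A').toLinearMap
  induction t with
  | zero => simp
  | add t t' ht ht' => simp only [map_add, ht, ht']
  | tmul a a' =>
    have h1 : ∀ z : A ⊗[k] H, TensorProduct.assoc k _ H H
        ((coactL k H A A').toLinearMap.rTensor H (σ H (z ⊗ₜ a'))) =
        σ (H ⊗[k] H) (TensorProduct.assoc k A H H (coact.toLinearMap.rTensor H z) ⊗ₜ a') := by
      intro z
      induction z with
      | zero => simp
      | add z z' hz hz' => simp only [map_add, TensorProduct.add_tmul, hz, hz']
      | tmul c h =>
        simp only [σ, LinearEquiv.coe_coe, TensorProduct.rightComm_tmul, LinearMap.rTensor_tmul,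
          AlgHom.toLinearMap_apply, coactL]
        simp only [AlgHom.comp_apply, Algebra.TensorProduct.map_tmul, AlgHom.id_apply]
        generalize coact (k := k) (H := H) c = y
        induction y with
        | zero => simp
        | add y y' hy hy' => simp only [map_add, TensorProduct.add_tmul, hy, hy']
        | tmul d g => simp
    have h2 : ∀ z : A ⊗[k] H, (comul (R := k) (A := H)).lTensor _ (σ H (z ⊗ₜ a')) =
        σ (H ⊗[k] H) ((comul (R := k) (A := H)).lTensor A z ⊗ₜ a') := by
      intro z
      induction z with
      | zero => simp
      | add z z' hz hz' => simp only [map_add, TensorProduct.add_tmul, hz, hz']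
      | tmul c h => simp [σ]
    have h3 : coactL k H A A' (a ⊗ₜ a') = σ H (coact (k := k) (H := H) a ⊗ₜ a') := by
      simp only [coactL, AlgHom.comp_apply, Algebra.TensorProduct.map_tmul, AlgHom.id_apply]
      generalize coact (k := k) (H := H) a = y
      induction y with
      | zero => simp
      | add y y' hy hy' => simp only [map_add, TensorProduct.add_tmul, hy, hy']
      | tmul d g => simp [σ]
    rw [h3, h1, h2, coact_coassoc]

theorem coactL_coactR (t : A ⊗[k] A') :
    TensorProduct.assoc k _ H H ((coactR k H A A').toLinearMap.rTensor H (coactL k H A A' t)) =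
      (TensorProduct.comm k H H).toLinearMap.lTensor _ (TensorProduct.assoc k _ H H
        ((coactL k H A A').toLinearMap.rTensor H (coactR k H A A' t))) := by
  induction t with
  | zero => simp
  | add t t' ht ht' => simp only [map_add, ht, ht']
  | tmul a a' =>
    have h3 : ∀ (c : A) (c' : A'), coactL k H A A' (c ⊗ₜ c') = TensorProduct.rightComm k A H A'
        (coact (k := k) (H := H) c ⊗ₜ c') := by
      intro c c'
      simp only [coactL, AlgHom.comp_apply, Algebra.TensorProduct.map_tmul, AlgHom.id_apply]
      generalize coact (k := k) (H := H) c = y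
      induction y with
      | zero => simp
      | add y y' hy hy' => simp only [map_add, TensorProduct.add_tmul, hy, hy']
      | tmul d g => simp
    have h4 : ∀ (c : A) (c' : A'), coactR k H A A' (c ⊗ₜ c') = (TensorProduct.assoc k A A' H).symm
        (c ⊗ₜ coact (k := k) (H := H) c') := by
      intro c c'
      simp only [coactR, AlgHom.comp_apply, Algebra.TensorProduct.map_tmul, AlgHom.id_apply]
      rfl
    have h1 : ∀ z : A ⊗[k] H, TensorProduct.assoc k _ H H ((coactR k H A A').toLinearMap.rTensor H
        (TensorProduct.rightComm k A H A' (z ⊗ₜ a'))) =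
        (TensorProduct.comm k H H).toLinearMap.lTensor _
          (TensorProduct.tensorTensorTensorComm k A H A' H (z ⊗ₜ coact (k := k) (H := H) a')) := by
      intro z
      induction z with
      | zero => simp
      | add z z' hz hz' => simp only [map_add, TensorProduct.add_tmul, hz, hz']
      | tmul c h =>
        simp only [TensorProduct.rightComm_tmul, LinearMap.rTensor_tmul,
          AlgHom.toLinearMap_apply, h4]
        generalize coact (k := k) (H := H) a' = y
        induction y with
        | zero => simp
        | add y y' hy hy' => simp only [map_add, TensorProduct.add_tmul, TensorProduct.tmul_add, hy, hy']
        | tmul d g => simp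
    have h2 : ∀ z : A' ⊗[k] H, TensorProduct.assoc k _ H H ((coactL k H A A').toLinearMap.rTensor H
        ((TensorProduct.assoc k A A' H).symm (a ⊗ₜ z))) =
          TensorProduct.tensorTensorTensorComm k A H A' H (coact (k := k) (H := H) a ⊗ₜ z) := by
      intro z
      induction z with
      | zero => simp
      | add z z' hz hz' => simp only [map_add, TensorProduct.tmul_add, hz, hz']
      | tmul c h =>
        simp only [TensorProduct.assoc_symm_tmul, LinearMap.rTensor_tmul,
          AlgHom.toLinearMap_apply, h3]
        generalize coact (k := k) (H := H) a = y
        induction y with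
        | zero => simp
        | add y y' hy hy' => simp only [map_add, TensorProduct.add_tmul, hy, hy']
        | tmul d g => simp
    rw [h3, h4, h1, h2]

end Cotensor
section Cotensor

open Coalgebra HopfAlgebra ComoduleAlgebra

variable {k : Type u} {H : Type w} {A : Type v} {A' : Type v} [Field k] [Ring H] [HopfAlgebra k H]
variable [Ring A] [Algebra k A] [ComoduleAlgebra k H A]
variable [Ring A'] [Algebra k A'] [ComoduleAlgebra k H A']

theorem rTensor_val_injective {E : Type*} [Ring E] [Algebra k E] (V : Subalgebra k E) :
    Function.Injective (V.val.toLinearMap.rTensor H) :=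
  Module.Flat.rTensor_preserves_injective_linearMap _ Subtype.val_injective

theorem coactL_mem [IsCocomm k H] (t : cotensor k H A A') :
    coactL k H A A' t ∈ LinearMap.range ((cotensor k H A A').val.toLinearMap.rTensor H) := by
  let D : A ⊗[k] A' →ₗ[k] (A ⊗[k] A') ⊗[k] H :=
    (coactL k H A A').toLinearMap - (coactR k H A A').toLinearMap
  have hex : Function.Exact (cotensor k H A A').val.toLinearMap D := fun t =>
    ⟨fun ht => ⟨⟨t, mem_cotensor.2 (sub_eq_zero.1 ht)⟩, rfl⟩, by
      rintro ⟨t, rfl⟩; exact sub_eq_zero.2 t.2⟩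
  refine (Module.Flat.rTensor_exact H hex _).1 ?_
  rw [LinearMap.rTensor_sub]
  change (coactL k H A A').toLinearMap.rTensor H (coactL k H A A' t) -
    (coactR k H A A').toLinearMap.rTensor H (coactL k H A A' t) = 0
  rw [sub_eq_zero]
  apply (TensorProduct.assoc k _ H H).injective
  rw [coactL_coactR, ← mem_cotensor.1 t.2, coactL_coassoc, ← LinearMap.lTensor_comp_apply,
    comm_comp_comul]

/-- The coaction `∑ aᵢ ⊗ a'ᵢ ↦ ∑ (aᵢ₀ ⊗ a'ᵢ) ⊗ aᵢ₁` on `A □ A'`. -/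
def cotensorCoact (k : Type u) (H : Type w) (A : Type v) (A' : Type v) [Field k] [Ring H]
    [HopfAlgebra k H] [IsCocomm k H] [Ring A] [Algebra k A] [ComoduleAlgebra k H A]
    [Ring A'] [Algebra k A'] [ComoduleAlgebra k H A'] :
    cotensor k H A A' →ₗ[k] cotensor k H A A' ⊗[k] H :=
  (LinearEquiv.ofInjective _ (rTensor_val_injective (cotensor k H A A'))).symm.toLinearMap ∘ₗ
    ((coactL k H A A').toLinearMap ∘ₗ (cotensor k H A A').val.toLinearMap).codRestrict _ coactL_mem

/-- The characteristic property of `cotensorCoact`. -/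
theorem rTensor_cotensorCoact [IsCocomm k H] (t : cotensor k H A A') :
    (cotensor k H A A').val.toLinearMap.rTensor H (cotensorCoact k H A A' t) =
      coactL k H A A' t :=
  congrArg Subtype.val ((LinearEquiv.ofInjective _
    (rTensor_val_injective (cotensor k H A A'))).apply_symm_apply _)

/-- The antipode as an algebra map `Hᵐᵒᵖ → H`. -/
def antipodeOp (k : Type u) (H : Type w) [Field k] [Ring H] [HopfAlgebra k H] : Hᵐᵒᵖ →ₐ[k] H :=
  (AlgEquiv.opOp k H).symm.toAlgHom.comp (AlgHom.op (antipodeAlgHomOp k H))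

@[simp] theorem antipodeOp_op (h : H) : antipodeOp k H (op h) = antipode k h := rfl

/-- `op a ↦ op a₀ ⊗ S(a₁)` -/
def coactOp (k : Type u) (H : Type w) (A : Type v) [Field k] [Ring H] [HopfAlgebra k H]
    [Ring A] [Algebra k A] [ComoduleAlgebra k H A] : Aᵐᵒᵖ →ₐ[k] Aᵐᵒᵖ ⊗[k] H :=
  (Algebra.TensorProduct.map (.id k Aᵐᵒᵖ) (antipodeOp k H)).comp <|
    (Algebra.TensorProduct.opAlgEquiv k k A H).symm.toAlgHom.comp (AlgHom.op coact)

theorem coactOp_op (a : A) : coactOp k H A (op a) =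
    TensorProduct.map (opLinearEquiv k).toLinearMap (antipode k) (coact (k := k) (H := H) a) := by
  change Algebra.TensorProduct.map (.id k Aᵐᵒᵖ) (antipodeOp k H)
    ((Algebra.TensorProduct.opAlgEquiv k k A H).symm (op (coact (k := k) (H := H) a))) = _
  generalize coact (k := k) (H := H) a = y
  induction y with
  | zero => simp
  | add y y' hy hy' => simp only [op_add, map_add, hy, hy']
  | tmul c h => simp

/-- The opposite algebra of a comodule algebra over a cocommutative Hopf algebra is a comodule
algebra, with coaction `op a ↦ op a₀ ⊗ S(a₁)`. -/
instance opComoduleAlgebra [IsCocomm k H] : ComoduleAlgebra k H Aᵐᵒᵖ where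
  coact := coactOp k H A
  coact_coassoc a := by
    induction a using MulOpposite.rec' with | _ a
    rw [coactOp_op]
    have h1 : ∀ z : A ⊗[k] H, TensorProduct.assoc k _ H H ((coactOp k H A).toLinearMap.rTensor H
        (TensorProduct.map (opLinearEquiv k).toLinearMap (antipode k) z)) =
        TensorProduct.map (opLinearEquiv k).toLinearMap (TensorProduct.map (antipode k) (antipode k))
          (TensorProduct.assoc k A H H (coact.toLinearMap.rTensor H z)) := by
      intro z
      induction z with
      | zero => simp
      | add z z' hz hz' => simp only [map_add, hz, hz']
      | tmul c h =>
        simp only [TensorProduct.map_tmul, LinearEquiv.coe_coe, coe_opLinearEquiv,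
          LinearMap.rTensor_tmul, AlgHom.toLinearMap_apply, coactOp_op]
        generalize coact (k := k) (H := H) c = y
        induction y with
        | zero => simp
        | add y y' hy hy' => simp only [map_add, TensorProduct.add_tmul, hy, hy']
        | tmul d g => simp
    have h2 : ∀ z : A ⊗[k] H, (comul (R := k) (A := H)).lTensor Aᵐᵒᵖ
        (TensorProduct.map (opLinearEquiv k).toLinearMap (antipode k) z) =
        TensorProduct.map (opLinearEquiv k).toLinearMap (TensorProduct.map (antipode k) (antipode k))
          ((comul (R := k) (A := H)).lTensor A z) := by
      intro z
      induction z with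
      | zero => simp
      | add z z' hz hz' => simp only [map_add, hz, hz']
      | tmul c h => simp [comul_antipode]
    rw [h1, h2, coact_coassoc]
  coact_counit a := by
    induction a using MulOpposite.rec' with | _ a
    rw [coactOp_op]
    have h1 : ∀ z : A ⊗[k] H, TensorProduct.rid k _ ((counit (R := k) (A := H)).lTensor Aᵐᵒᵖ
        (TensorProduct.map (opLinearEquiv k).toLinearMap (antipode k) z)) =
        op (TensorProduct.rid k A ((counit (R := k) (A := H)).lTensor A z)) := by
      intro z
      induction z with
      | zero => simp
      | add z z' hz hz' => simp only [map_add, hz, hz', op_add]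
      | tmul c h => simp
    rw [h1, coact_counit]

end Cotensor

/-! ### Stable bimodules -/

section Stable

/-- Left multiplication on an algebra. -/
def leftMul (k : Type*) (E : Type*) [Field k] [Ring E] [Algebra k E] : E →ₐ[k] Module.End k E :=
  Algebra.lsmul k k E

/-- Right multiplication on an algebra. -/
def rightMul (k : Type*) (E : Type*) [Field k] [Ring E] [Algebra k E] :
    Eᵐᵒᵖ →ₐ[k] Module.End k E :=
  Algebra.lsmul k k E

theorem leftMul_apply {k : Type*} {E : Type*} [Field k] [Ring E] [Algebra k E] (a x : E) :
    leftMul k E a x = a * x := rfl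

theorem rightMul_apply {k : Type*} {E : Type*} [Field k] [Ring E] [Algebra k E] (a : Eᵐᵒᵖ) (x : E) :
    rightMul k E a x = x * unop a := rfl

theorem leftMul_rightMul {k : Type*} {E : Type*} [Field k] [Ring E] [Algebra k E] (c : E)
    (a : Eᵐᵒᵖ) (x : E) :
    leftMul k E c (rightMul k E a x) = rightMul k E a (leftMul k E c x) :=
  (mul_assoc c x (unop a)).symm

theorem rTensor_rightMul {k : Type*} {E E' H : Type*} [Field k] [Ring E] [Algebra k E] [Ring E']
    [Algebra k E'] [Ring H] [Algebra k H] (f : E →ₐ[k] E') (c : E) (z : E ⊗[k] H) :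
    f.toLinearMap.rTensor H ((rightMul k E (op c)).rTensor H z) =
      f.toLinearMap.rTensor H z * (f c ⊗ₜ 1) := by
  induction z with
  | zero => simp
  | add z z' hz hz' => simp only [map_add, hz, hz', add_mul]
  | tmul s h => simp [rightMul_apply]

open Coalgebra HopfAlgebra ComoduleAlgebra

section
variable (k : Type u) (H : Type w) (A : Type v) [Field k] [Ring H] [HopfAlgebra k H] [IsCocomm k H]
variable [Ring A] [Algebra k A] [ComoduleAlgebra k H A]

/-- The algebra `A □ Aᵐᵒᵖ`. -/
def BoxEnv : Type v := cotensor k H A Aᵐᵒᵖ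

instance : Ring (BoxEnv k H A) := inferInstanceAs (Ring (cotensor k H A Aᵐᵒᵖ))
instance : Algebra k (BoxEnv k H A) := inferInstanceAs (Algebra k (cotensor k H A Aᵐᵒᵖ))

/-- The inclusion of `A □ Aᵐᵒᵖ` in `A ⊗ Aᵐᵒᵖ`. -/
def boxVal : BoxEnv k H A →ₐ[k] A ⊗[k] Aᵐᵒᵖ := (cotensor k H A Aᵐᵒᵖ).val

/-- The coaction `∑ aᵢ ⊗ a'ᵢ ↦ ∑ (aᵢ₀ ⊗ a'ᵢ) ⊗ aᵢ₁` on `A □ Aᵐᵒᵖ`. -/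
def boxCoact : BoxEnv k H A →ₗ[k] BoxEnv k H A ⊗[k] H := cotensorCoact k H A Aᵐᵒᵖ

theorem rTensor_boxVal_injective : Function.Injective ((boxVal k H A).toLinearMap.rTensor H) :=
  rTensor_val_injective (cotensor k H A Aᵐᵒᵖ)

theorem rTensor_boxCoact (t : BoxEnv k H A) :
    (boxVal k H A).toLinearMap.rTensor H (boxCoact k H A t) =
      coactL k H A Aᵐᵒᵖ (boxVal k H A t) :=
  rTensor_cotensorCoact (A' := Aᵐᵒᵖ) t

/-- The inclusion of `B ⊗ Bᵐᵒᵖ` in `A □ Aᵐᵒᵖ`, where `B` is the algebra of coinvariants. -/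
def envIncl : coinv k H A ⊗[k] (coinv k H A)ᵐᵒᵖ →ₐ[k] BoxEnv k H A :=
  (Algebra.TensorProduct.map (coinv k H A).val (AlgHom.op (coinv k H A).val)).codRestrict _ (by
    intro z
    rw [mem_cotensor]
    induction z with
    | zero => simp
    | add z z' hz hz' => simp only [map_add, hz, hz']
    | tmul b c =>
      have hb : coact (k := k) (H := H) (b : A) = (b : A) ⊗ₜ 1 := b.2
      have hc : coact (k := k) (H := H) (op ((unop c : coinv k H A) : A)) =
          op ((unop c : coinv k H A) : A) ⊗ₜ 1 := by
        refine (coactOp_op _).trans ?_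
        rw [show coact (k := k) (H := H) ((unop c : coinv k H A) : A) = _ ⊗ₜ 1 from (unop c).2]
        simp
      change coactL k H A Aᵐᵒᵖ ((b : A) ⊗ₜ op ((unop c : coinv k H A) : A)) =
        coactR k H A Aᵐᵒᵖ ((b : A) ⊗ₜ op ((unop c : coinv k H A) : A))
      simp [coactL, coactR, hb, hc])

theorem coactL_envIncl (c : coinv k H A ⊗[k] (coinv k H A)ᵐᵒᵖ) :
    coactL k H A Aᵐᵒᵖ (boxVal k H A (envIncl k H A c)) = boxVal k H A (envIncl k H A c) ⊗ₜ 1 := by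
  induction c with
  | zero => simp
  | add z z' hz hz' => simp only [map_add, hz, hz', TensorProduct.add_tmul]
  | tmul b c =>
    have hb : coact (k := k) (H := H) (b : A) = (b : A) ⊗ₜ 1 := b.2
    change coactL k H A Aᵐᵒᵖ ((b : A) ⊗ₜ op ((unop c : coinv k H A) : A)) =
      ((b : A) ⊗ₜ op ((unop c : coinv k H A) : A)) ⊗ₜ 1
    simp [coactL, hb]

/-- `A ⊗ Aᵐᵒᵖ` as a `B`-bimodule: `b * (a ⊗ a') * c = b a ⊗ a' c`, products taken in `A`. -/
def envBimod : Bimodule.{u, v, v} k (coinv k H A) :=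
  .ofEnv ((leftMul k (A ⊗[k] Aᵐᵒᵖ)).comp
    ((boxVal k H A).comp (envIncl k H A)))

/-- `A □ Aᵐᵒᵖ` as a `B`-bimodule: `b * (∑ aᵢ ⊗ a'ᵢ) * c = ∑ b aᵢ ⊗ a'ᵢ c`. -/
def boxBimod : Bimodule.{u, v, v} k (coinv k H A) :=
  .ofEnv ((leftMul k (BoxEnv k H A)).comp
    (envIncl k H A))

/-- `A □ Aᵐᵒᵖ` as a right `B ⊗ Bᵐᵒᵖ`-module (by multiplication in `A ⊗ Aᵐᵒᵖ`). -/
def boxRight : (coinv k H A ⊗[k] (coinv k H A)ᵐᵒᵖ)ᵐᵒᵖ →ₐ[k] Module.End k (BoxEnv k H A) :=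
  (rightMul k (BoxEnv k H A)).comp
    (AlgHom.op (envIncl k H A))

variable {A}

/-- The `B`-bimodule `(A □ Aᵐᵒᵖ) ⊗_{B ⊗ Bᵐᵒᵖ} M`. -/
def indTensor (M : Bimodule.{u, v, v} k (coinv k H A)) : Bimodule.{u, v, v} k (coinv k H A) :=
  .ofEnv (X := Balanced (boxRight k H A) M.env)
    (Balanced.actLeft (boxRight k H A) M.env
      ((leftMul k (BoxEnv k H A)).comp
        (envIncl k H A))
      (fun a c x => leftMul_rightMul (envIncl k H A c) (AlgHom.op (envIncl k H A) a) x))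

end

variable {k : Type u} {H : Type w} {A : Type v} [Field k] [Ring H] [HopfAlgebra k H] [IsCocomm k H]
variable [Ring A] [Algebra k A] [ComoduleAlgebra k H A]

section
variable (H)
variable (M N : Bimodule.{u, v, v} k (coinv k H A))

/-- `t ⊗ m` in `(A □ Aᵐᵒᵖ) ⊗_{B ⊗ Bᵐᵒᵖ} M`, as a bilinear map. -/
def indTmul : BoxEnv k H A →ₗ[k] M →ₗ[k] indTensor k H M :=
  Balanced.tmulHom (boxRight k H A) M.env

theorem boxCoact_mul (t : BoxEnv k H A) (c : coinv k H A ⊗[k] (coinv k H A)ᵐᵒᵖ) :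
    boxCoact k H A (boxRight k H A (op c) t) =
      (boxRight k H A (op c)).rTensor H (boxCoact k H A t) := by
  apply rTensor_boxVal_injective
  have h := rTensor_rightMul (H := H) (boxVal k H A) (envIncl k H A c) (boxCoact k H A t)
  refine Eq.trans ?_ h.symm
  rw [rTensor_boxCoact, rTensor_boxCoact, ← coactL_envIncl, ← map_mul]
  rfl

/-- The coaction `(∑ aᵢ ⊗ a'ᵢ) ⊗ m ↦ ∑ (aᵢ₀ ⊗ a'ᵢ) ⊗ m ⊗ aᵢ₁` on
`(A □ Aᵐᵒᵖ) ⊗_{B ⊗ Bᵐᵒᵖ} M`. -/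
def indCoact : indTensor k H M →ₗ[k] indTensor k H M ⊗[k] H :=
  Balanced.lift (r := boxRight k H A) (l := M.env)
    (LinearMap.flip (LinearMap.lcomp k _ (boxCoact k H A) ∘ₗ
      LinearMap.rTensorHom H ∘ₗ (indTmul H M).flip))
    (by
      intro t c m
      simp only [LinearMap.flip_apply, LinearMap.comp_apply, LinearMap.lcomp_apply,
        LinearMap.coe_rTensorHom, boxCoact_mul, ← LinearMap.rTensor_comp_apply]
      congr 2
      ext s
      exact Balanced.tmul_act _ _ _)

theorem indCoact_indTmul (t : BoxEnv k H A) (m : M) :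
    indCoact H M (indTmul H M t m) =
      ((indTmul H M).flip m).rTensor H (boxCoact k H A t) :=
  Balanced.lift_tmul _ _ _ _

end

section
variable {B : Type v} [Ring B] [Algebra k B] (H) (M N : Bimodule.{u, v, v} k B)

/-- The `B`-bimodule `M ⊗ H`, with `b * (m ⊗ h) * c = b m c ⊗ h`. -/
def tensorH : Bimodule.{u, v, max v w} k B where
  carrier := M ⊗[k] H
  left := (Module.End.rTensorAlgHom k M H).comp M.left
  right := (Module.End.rTensorAlgHom k M H).comp M.right
  left_right b c m := by
    induction m with
    | zero => simp
    | add z z' hz hz' => simp only [map_add, hz, hz']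
    | tmul m h => exact congrArg (· ⊗ₜ h) (M.left_right b c m)

/-- The coaction `m ⊗ h ↦ m ⊗ h₁ ⊗ h₂` on `M ⊗ H`. -/
def tensorHCoact : tensorH H M →ₗ[k] tensorH H M ⊗[k] H :=
  (TensorProduct.assoc k M H H).symm.toLinearMap ∘ₗ (comul (R := k) (A := H)).lTensor M

/-- `(m ⊗ h) ⊗_B (n ⊗ h')`, as a function of the four arguments. -/
def mulH : M ⊗[k] N →ₗ[k] H ⊗[k] H →ₗ[k] (tensorH H M).tensor (tensorH H N) :=
  TensorProduct.curry ((balancedRel (tensorH H M).right (tensorH H N).left).mkQ ∘ₗ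
    (TensorProduct.tensorTensorTensorComm k M N H H).toLinearMap)

/-- The map `κ : (M ⊗_B N) ⊗ H → (M ⊗ H) ⊗_B (N ⊗ H)`, `m ⊗ n ⊗ h ↦ (m ⊗ h₁) ⊗ (n ⊗ h₂)`. -/
def kappa : tensorH H (M.tensor N) →ₗ[k] (tensorH H M).tensor (tensorH H N) :=
  TensorProduct.lift (Bimodule.tensorLift (M := M) (N := N)
    (TensorProduct.mk k M N |>.compr₂ ((LinearMap.lcomp k _ (comul (R := k) (A := H))) ∘ₗ
      mulH H M N))
    (by
      intro m b n
      ext h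
      simp only [LinearMap.compr₂_apply, LinearMap.comp_apply, LinearMap.lcomp_apply, mk_apply]
      generalize comul (R := k) h = z
      induction z with
      | zero => simp
      | add z z' hz hz' => simp only [map_add, hz, hz']
      | tmul g g' =>
        exact Bimodule.tmul_act (M := tensorH H M) (N := tensorH H N) (m ⊗ₜ g) b (n ⊗ₜ g')))

end

end Stable

section Stable

open Coalgebra HopfAlgebra ComoduleAlgebra

variable {k : Type u} {H : Type w} {A : Type v} [Field k] [Ring H] [HopfAlgebra k H] [IsCocomm k H]
variable [Ring A] [Algebra k A] [ComoduleAlgebra k H A]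

theorem boxRight_indTmul {M : Bimodule.{u, v, v} k (coinv k H A)} (t : BoxEnv k H A)
    (c : coinv k H A ⊗[k] (coinv k H A)ᵐᵒᵖ) (m : M) :
    indTmul H M (boxRight k H A (op c) t) m = indTmul H M t (M.env c m) :=
  Balanced.tmul_act _ _ _

/-- An `H`-colinear isomorphism `φ : (A □ Aᵐᵒᵖ) ⊗_{B ⊗ Bᵐᵒᵖ} M → M ⊗ H` of bimodules. -/
structure StableIso (H : Type w) [Ring H] [HopfAlgebra k H] [IsCocomm k H] [ComoduleAlgebra k H A]
    (M : Bimodule.{u, v, v} k (coinv k H A)) extends Bimodule.Iso (indTensor k H M) (tensorH H M) where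
  colinear : ∀ z, tensorHCoact H M (toEquiv z) = toEquiv.toLinearMap.rTensor H (indCoact H M z)

variable (k H) in
/-- For fixed `a, a'`, the map `A ⊗_B A → (A ⊗ Aᵐᵒᵖ) ⊗_B (A ⊗ Aᵐᵒᵖ)`,
`c ⊗ c' ↦ (a ⊗ c) ⊗ (c' ⊗ a')`. -/
def insertMid (a : A) (a' : Aᵐᵒᵖ) :
    TensorSq k H A →ₗ[k] (envBimod k H A).tensor (envBimod k H A) :=
  Balanced.map (TensorProduct.mk k A Aᵐᵒᵖ a ∘ₗ (opLinearEquiv k).toLinearMap)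
    ((TensorProduct.mk k A Aᵐᵒᵖ).flip a')
    (by
      intro b (c : A)
      change a ⊗ₜ op (c * ((unop b : coinv k H A) : A)) =
        ((1 : A) ⊗ₜ[k] op ((unop b : coinv k H A) : A)) * (a ⊗ₜ op c)
      simp)
    (by
      intro b (c : A)
      change ((b : A) * c) ⊗ₜ a' = ((b : A) ⊗ₜ[k] op ((1 : coinv k H A) : A)) * (c ⊗ₜ a')
      simp)

theorem insertMid_tmulA (a : A) (a' : Aᵐᵒᵖ) (c c' : A) :
    insertMid k H a a' (tmulA H c c') =
      (envBimod k H A).tmul (envBimod k H A) (a ⊗ₜ op c) (c' ⊗ₜ a') :=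
  Balanced.map_tmul _ _ _ _ _ _

/-- `insertMid` as a multilinear map. -/
def insertMidHom (k : Type u) (H : Type w) (A : Type v) [Field k] [Ring H] [HopfAlgebra k H]
    [IsCocomm k H] [Ring A] [Algebra k A] [ComoduleAlgebra k H A] :
    A →ₗ[k] Aᵐᵒᵖ →ₗ[k] TensorSq k H A →ₗ[k] (envBimod k H A).tensor (envBimod k H A) :=
  LinearMap.mk₂ k (insertMid k H)
    (fun a b a' => Bimodule.tensor_hom_ext fun (c c' : A) => by
      have := insertMid_tmulA (k := k) (H := H) (a + b) a' c c'
      rw [TensorProduct.add_tmul] at this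
      refine this.trans ((Bimodule.add_tmul _ _ _).trans ?_)
      exact (congrArg₂ (· + ·) (insertMid_tmulA a a' c c') (insertMid_tmulA b a' c c')).symm)
    (fun r a a' => Bimodule.tensor_hom_ext fun (c c' : A) => by
      have := insertMid_tmulA (k := k) (H := H) (r • a) a' c c'
      rw [← TensorProduct.smul_tmul'] at this
      refine this.trans ((Bimodule.smul_tmul _ _ _).trans ?_)
      exact (congrArg (r • ·) (insertMid_tmulA a a' c c')).symm)
    (fun a a' b => Bimodule.tensor_hom_ext fun (c c' : A) => by
      have := insertMid_tmulA (k := k) (H := H) a (a' + b) c c'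
      rw [TensorProduct.tmul_add] at this
      refine this.trans ((Bimodule.tmul_add _ _ _).trans ?_)
      exact (congrArg₂ (· + ·) (insertMid_tmulA a a' c c') (insertMid_tmulA a b c c')).symm)
    (fun r a a' => Bimodule.tensor_hom_ext fun (c c' : A) => by
      have := insertMid_tmulA (k := k) (H := H) a (r • a') c c'
      rw [TensorProduct.tmul_smul] at this
      refine this.trans ((Bimodule.tmul_smul _ _ _).trans ?_)
      exact (congrArg (r • ·) (insertMid_tmulA a a' c c')).symm)

/-- The map `A ⊗ Aᵐᵒᵖ → (A ⊗ Aᵐᵒᵖ) ⊗_B (A ⊗ Aᵐᵒᵖ)`,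
`a ⊗ a' ↦ ∑ (a₀ ⊗ lᵢ(a₁)) ⊗ (rᵢ(a₁) ⊗ a')`. -/
def splitEnv (hA : IsFaithfullyFlatGalois k H A) :
    A ⊗[k] Aᵐᵒᵖ →ₗ[k] (envBimod k H A).tensor (envBimod k H A) :=
  TensorProduct.lift (LinearMap.lcomp k _ (translation hA) ∘ₗ
    TensorProduct.lift (insertMidHom k H A)) ∘ₗ (coactL k H A Aᵐᵒᵖ).toLinearMap

theorem boxVal_bilinear : Bimodule.IsBilinear (M := boxBimod k H A) (N := envBimod k H A)
    (boxVal k H A).toLinearMap :=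
  ⟨fun _ _ => map_mul (boxVal k H A) _ _, fun _ _ => map_mul (boxVal k H A) _ _⟩

/-- The image of `t = ∑ aᵢ ⊗ a'ᵢ` in `A □ Aᵐᵒᵖ` under `splitEnv` belongs to the image of
`(A □ Aᵐᵒᵖ) ⊗_B (A □ Aᵐᵒᵖ)` (a subspace of `(A ⊗ Aᵐᵒᵖ) ⊗_B (A ⊗ Aᵐᵒᵖ)` if `A □ Aᵐᵒᵖ` is
`B`-flat). This says that it is given by `c`. -/
def IsSplitting (hA : IsFaithfullyFlatGalois k H A) (t : BoxEnv k H A)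
    (c : (boxBimod k H A).tensor (boxBimod k H A)) : Prop :=
  Bimodule.mapTensor (M' := envBimod k H A) (N' := envBimod k H A) (boxVal k H A).toLinearMap
    (boxVal k H A).toLinearMap boxVal_bilinear boxVal_bilinear c = splitEnv hA (boxVal k H A t)

section
variable {M N : Bimodule.{u, v, v} k (coinv k H A)}

theorem indTmul_bilinear (m : M) : Bimodule.IsBilinear (M := boxBimod k H A) (N := indTensor k H M)
    ((indTmul H M).flip m) :=
  ⟨fun _ _ => rfl, fun _ _ => rfl⟩

/-- The map `s ⊗ s' ↦ (s ⊗ m) ⊗_B (s' ⊗ n)`. -/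
def insertTensor (m : M) (n : N) : (boxBimod k H A).tensor (boxBimod k H A) →ₗ[k]
    (indTensor k H M).tensor (indTensor k H N) :=
  Bimodule.mapTensor ((indTmul H M).flip m) ((indTmul H N).flip n) (indTmul_bilinear m)
    (indTmul_bilinear n)

/-- The condition `κ ∘ φ = (φM ⊗_B φN) ∘ g`, where
`g (t ⊗ (m ⊗ n)) = ∑ ((a₀ ⊗ lᵢ(a₁)) ⊗ m) ⊗_B ((rᵢ(a₁) ⊗ a') ⊗ n)` for `t = ∑ a ⊗ a'`:
the map `φ` is the isomorphism `φ_{M ⊗ N}` determined by `φM` and `φN`. -/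
def IsTensorIso (hA : IsFaithfullyFlatGalois k H A) (φM : StableIso H M) (φN : StableIso H N)
    (φ : indTensor k H (M.tensor N) →ₗ[k] tensorH H (M.tensor N)) : Prop :=
  ∀ t c, IsSplitting hA t c → ∀ m n,
    kappa H M N (φ (indTmul H (M.tensor N) t (M.tmul N m n))) =
      Bimodule.mapTensor _ _ φM.bilinear φN.bilinear (insertTensor m n c)

end

variable (k A) in
/-- The action of `A ⊗ Aᵐᵒᵖ` on `A`: `(a ⊗ a') b = a b a'`. -/
def envAct : A ⊗[k] Aᵐᵒᵖ →ₐ[k] Module.End k A :=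
  Algebra.TensorProduct.lift (leftMul k A) (rightMul k A) fun a c =>
    show Commute _ _ from LinearMap.ext (leftMul_rightMul a c)

theorem envAct_tmul (a : A) (c : Aᵐᵒᵖ) (b : A) : envAct k A (a ⊗ₜ c) b = a * (b * unop c) := by
  rw [envAct, Algebra.TensorProduct.lift_tmul]; rfl

theorem rTensor_act {k : Type*} {E H V : Type*} [Field k] [Ring E] [Algebra k E] [Ring H]
    [Algebra k H] [AddCommGroup V] [Module k V] (f : E →ₐ[k] Module.End k V)
    (b : V) (z : E ⊗[k] H) (s : E) :
    (f.toLinearMap.flip b).rTensor H (z * (s ⊗ₜ 1)) =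
      (f.toLinearMap.flip (f s b)).rTensor H z := by
  induction z with
  | zero => simp
  | add z z' hz hz' => simp only [map_add, hz, hz', add_mul]
  | tmul t h => simp

variable (k H A) in
/-- The inclusion of `B` in `A`. -/
def inclB : Bimodule.regular k (coinv k H A) →ₗ[k] A := (coinv k H A).val.toLinearMap

theorem coe_env_regular (c : coinv k H A ⊗[k] (coinv k H A)ᵐᵒᵖ)
    (b : Bimodule.regular k (coinv k H A)) :
    inclB k H A ((Bimodule.regular k (coinv k H A)).env c b) =
      envAct k A (boxVal k H A (envIncl k H A c)) (inclB k H A b) := by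
  induction c with
  | zero => simp
  | add z z' hz hz' => simp only [map_add, LinearMap.add_apply, hz, hz']
  | tmul d e =>
    rw [Bimodule.env_tmul]
    exact (envAct_tmul (k := k) (d : A) (op ((unop e : coinv k H A) : A)) (inclB k H A b)).symm

variable (k H A) in
/-- The map `(∑ aᵢ ⊗ a'ᵢ) ⊗ b ↦ ∑ aᵢ₀ b a'ᵢ ⊗ aᵢ₁` from `(A □ Aᵐᵒᵖ) ⊗_{B ⊗ Bᵐᵒᵖ} B`, with values in
`A ⊗ H`. -/
def phiB : indTensor k H (Bimodule.regular k (coinv k H A)) →ₗ[k] A ⊗[k] H :=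
  Balanced.lift (r := boxRight k H A) (l := (Bimodule.regular k (coinv k H A)).env)
    (LinearMap.flip (LinearMap.lcomp k _
        ((coactL k H A Aᵐᵒᵖ).toLinearMap ∘ₗ (boxVal k H A).toLinearMap) ∘ₗ
      LinearMap.rTensorHom H ∘ₗ (envAct k A).toLinearMap.flip ∘ₗ
        inclB k H A))
    (by
      intro t c b
      have h : boxVal k H A (boxRight k H A (op c) t) =
        boxVal k H A t * boxVal k H A (envIncl k H A c) := map_mul (boxVal k H A) _ _
      change ((envAct k A).toLinearMap.flip (inclB k H A b)).rTensor H
        (coactL k H A Aᵐᵒᵖ (boxVal k H A (boxRight k H A (op c) t))) =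
          ((envAct k A).toLinearMap.flip _).rTensor H _
      rw [h, map_mul, coactL_envIncl, rTensor_act, ← coe_env_regular]
      rfl)

/-- A strict Morita context `(B, B, M, N, α, β)` is `H`-stable if there are isomorphisms
`φM : (A □ Aᵐᵒᵖ) ⊗_{B ⊗ Bᵐᵒᵖ} M → M ⊗ H` and `φN : (A □ Aᵐᵒᵖ) ⊗_{B ⊗ Bᵐᵒᵖ} N → N ⊗ H` such that
`φ_B ∘ ((A □ Aᵐᵒᵖ) ⊗ α) = (α ⊗ H) ∘ φ_{M ⊗ N}` and `φ_B ∘ ((A □ Aᵐᵒᵖ) ⊗ β) = (β ⊗ H) ∘ φ_{N ⊗ M}`.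
Both sides of these equations take values in `B ⊗ H`, a subspace of `A ⊗ H`. -/
def MoritaContext.IsHStable (hA : IsFaithfullyFlatGalois k H A)
    (C : MoritaContext k (coinv k H A)) : Prop :=
  ∃ (φM : StableIso H C.M) (φN : StableIso H C.N)
    (φMN : indTensor k H (C.M.tensor C.N) →ₗ[k] tensorH H (C.M.tensor C.N))
    (φNM : indTensor k H (C.N.tensor C.M) →ₗ[k] tensorH H (C.N.tensor C.M)),
    IsTensorIso hA φM φN φMN ∧ IsTensorIso hA φN φM φNM ∧
    (∀ t z, phiB k H A (indTmul H (Bimodule.regular k (coinv k H A)) t (C.α.toEquiv z)) =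
      (inclB k H A ∘ₗ C.α.toEquiv.toLinearMap).rTensor H (φMN (indTmul H (C.M.tensor C.N) t z))) ∧
    (∀ t z, phiB k H A (indTmul H (Bimodule.regular k (coinv k H A)) t (C.β.toEquiv z)) =
      (inclB k H A ∘ₗ C.β.toEquiv.toLinearMap).rTensor H (φNM (indTmul H (C.N.tensor C.M) t z)))

/-- The `H`-stable part of `Pic B`: the subgroup of `Pic B` formed by the classes of the `H`-stable
strict Morita contexts. (These classes are closed under products and inverses; the subgroup which
they generate has no further elements.) -/
def PicH (hA : IsFaithfullyFlatGalois k H A) : Subgroup (Pic k (coinv k H A)) :=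
  Subgroup.closure {p | ∃ C : MoritaContext k (coinv k H A), C.IsHStable hA ∧ C.toPic = p}

end Stable

/-! ### Sweedler cohomology -/

section Sweedler

open Coalgebra

/-- A cocommutative coalgebra. -/
structure CocommCoalgebra (k : Type u) [Field k] where
  carrier : Type u
  [addCommGroup : AddCommGroup carrier]
  [module : Module k carrier]
  [coalgebra : Coalgebra k carrier]
  [isCocomm : IsCocomm k carrier]

attribute [instance] CocommCoalgebra.addCommGroup CocommCoalgebra.module
  CocommCoalgebra.coalgebra CocommCoalgebra.isCocomm

section
variable (k : Type u) (H : Type u) [Field k] [Ring H] [Bialgebra k H] [IsCocomm k H]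

/-- The coalgebra `H ⊗ (H ⊗ ⋯ (H ⊗ k))`, with `n` factors `H`. -/
def tensorPower : ℕ → CocommCoalgebra k
  | 0 => ⟨k⟩
  | n + 1 => ⟨H ⊗[k] (tensorPower n).carrier⟩

/-- `H^{⊗ n}` -/
abbrev TPow (n : ℕ) : Type u := (tensorPower k H n).carrier

variable {k} in
/-- `h ⊗ (h' ⊗ x) ↦ h h' ⊗ x` -/
def mulFirst (X : Type u) [AddCommGroup X] [Module k X] [Coalgebra k X] :
    H ⊗[k] (H ⊗[k] X) →ₗc[k] H ⊗[k] X :=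
  (Coalgebra.TensorProduct.map (Bialgebra.mulCoalgHom k H) (CoalgHom.id k X)).comp
    (Coalgebra.TensorProduct.assoc k k H H X).symm.toCoalgHom

/-- The maps `H^{⊗ (n + 1)} → H^{⊗ n}` given by multiplication of two consecutive factors
and (for the last one) by the counit on the last factor. -/
def face : (n : ℕ) → Fin (n + 1) → (TPow k H (n + 1) →ₗc[k] TPow k H n)
  | 0, _ => (counitCoalgHom k (H ⊗[k] k) : H ⊗[k] k →ₗc[k] k)
  | n + 1, i => Fin.cases (motive := fun _ => TPow k H (n + 2) →ₗc[k] TPow k H (n + 1))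
      (mulFirst H (TPow k H n))
      (fun j => Coalgebra.TensorProduct.map (CoalgHom.id k H) (face n j)) i

end

section
variable {k : Type u} {H : Type u} {R : Type w} [Field k] [CommRing R] [Algebra k R]

/-- Composition with a coalgebra map, on convolution algebras. -/
def convComp {C D : Type u} [AddCommGroup C] [Module k C] [Coalgebra k C]
    [AddCommGroup D] [Module k D] [Coalgebra k D] (R : Type w) [CommRing R] [Algebra k R]
    (φ : C →ₗc[k] D) : WithConv (D →ₗ[k] R) →* WithConv (C →ₗ[k] R) where
  toFun f := .toConv (f.ofConv ∘ₗ φ.toLinearMap)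
  map_one' := by ext c; simp
  map_mul' f g := congrArg WithConv.toConv (LinearMap.convMul_comp_coalgHom_distrib f g φ)

variable [Ring H] [Bialgebra k H]

/-- The map `f ↦ (h ⊗ x ↦ h · f x)` on convolution algebras. -/
def convAct (ma : ModuleAlgebra k H R) (X : Type u) [AddCommGroup X] [Module k X]
    [Coalgebra k X] : WithConv (X →ₗ[k] R) →* WithConv (H ⊗[k] X →ₗ[k] R) where
  toFun f := .toConv (TensorProduct.lift (ma.act.compl₂ f.ofConv))
  map_one' := by
    ext h x
    simp [Algebra.algebraMap_eq_smul_one, ma.act_one, smul_smul, mul_comm]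
  map_mul' f g := by
    ext h x
    simp only [LinearMap.convMul_apply, AlgebraTensorModule.curry_apply, LinearMap.restrictScalars_self,
      TensorProduct.curry_apply, TensorProduct.lift.tmul, LinearMap.compl₂_apply,
      TensorProduct.comul_tmul]
    generalize comul (R := k) x = z
    induction z with
    | zero => simp
    | add z z' hz hz' => simp only [map_add, hz, hz', TensorProduct.tmul_add]
    | tmul y y' =>
      simp [ma.act_mul]
      generalize comul (R := k) h = z
      induction z with
      | zero => simp
      | add z z' hz hz' => simp only [map_add, hz, hz', TensorProduct.add_tmul]
      | tmul g g' => simp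

/-- The group of convolution invertible maps `H^{⊗ n} → R`. -/
abbrev Cochain (k : Type u) (H : Type u) (R : Type w) [Field k] [CommRing R] [Algebra k R]
    [Ring H] [Bialgebra k H] [IsCocomm k H] (n : ℕ) : Type _ :=
  (WithConv (TPow k H n →ₗ[k] R))ˣ

variable [IsCocomm k H] (ma : ModuleAlgebra k H R)

/-- The differential of the Sweedler complex: `d f (h₀ ⊗ ⋯ ⊗ hₙ)` is the convolution product of
`h₀ · f (h₁ ⊗ ⋯ ⊗ hₙ)`, of `f^{±1} (⋯ ⊗ hᵢ hᵢ₊₁ ⊗ ⋯)` with sign `(-1) ^ (i + 1)`, and of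
`f^{±1} (h₀ ⊗ ⋯ ⊗ hₙ₋₁) ε(hₙ)` with sign `(-1) ^ (n + 1)`. -/
def sweedlerD (n : ℕ) : Cochain k H R n →* Cochain k H R (n + 1) :=
  (Units.map (convAct ma (TPow k H n)) : Cochain k H R n →* Cochain k H R (n + 1)) *
    ∏ i : Fin (n + 1), Units.map (convComp R (face k H n i)) ^ ((-1 : ℤ) ^ (i.val + 1))

/-- Sweedler `n`-cocycles. -/
def sweedlerZ (n : ℕ) : Subgroup (Cochain k H R n) := (sweedlerD ma n).ker

/-- Sweedler `n`-coboundaries. -/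
def sweedlerB : (n : ℕ) → Subgroup (Cochain k H R n)
  | 0 => ⊥
  | n + 1 => (sweedlerD ma n).range

/-- Sweedler cohomology `Hⁿ(H, R)`. -/
def SweedlerH (n : ℕ) : Type _ := sweedlerZ ma n ⧸ (sweedlerB ma n).subgroupOf (sweedlerZ ma n)

instance (n : ℕ) : CommGroup (SweedlerH ma n) :=
  inferInstanceAs (CommGroup (sweedlerZ ma n ⧸ (sweedlerB ma n).subgroupOf (sweedlerZ ma n)))

/-- The cohomology class of a cocycle. -/
def SweedlerH.mk (n : ℕ) : sweedlerZ ma n →* SweedlerH ma n :=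
  QuotientGroup.mk' ((sweedlerB ma n).subgroupOf (sweedlerZ ma n))

end

end Sweedler

end

end HPicard

open HPicard

namespace HPicard

noncomputable section

/-! ### Endomorphisms of invertible bimodules -/

namespace Bimodule

variable {k : Type u} [Field k] {B : Type v} [Ring B] [Algebra k B]

/-! Action on the center. If `M ⊗_B N ≅ B` and `N ⊗_B M ≅ B`, then the bimodule endomorphisms of `M`
are those of `B`, that is, left multiplications by central elements (`exists_center_of_isBilinear`),
and the central element is unique because `M` is faithful (`left_injective_of_tensor`). Right
multiplication by `x ∈ Z(B)` is such an endomorphism, so `m x = ξ(x) m` defines `ξ = ξ_M`. Reading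
this relation on products and on tensor products shows that `ξ_M` is an algebra map and that `ξ_{M ⊗
N} = ξ_M ∘ ξ_N`.

Equivariance. For `y ∈ Z(B)` and `a ∈ A` one has `a y = (a₁ · y) a₀` (`leftMulBy_mu`); this is where
cocommutativity enters. Let `t` be in `A □ Aᵐᵒᵖ`, with coaction `t₀ ⊗ t₁`. The commutation rule in
the second factor, followed by the cotensor condition, which moves the coaction to the first factor,
gives `(1 ⊗ x) t = t₀ (1 ⊗ S(t₁) · x)` (`boxInr_mul`). After tensoring with `m ∈ M`, the scalar
`S(t₁) · x` crosses the tensor sign, becomes `ξ(S(t₁) · x)` on the left of `m`, crosses back into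
the first factor, and moves to the left of `t₀` by the commutation rule there. Hence `z x = Ψ(z₁)
z₀` on `(A □ Aᵐᵒᵖ) ⊗ M`, where `Ψ(h) = h₁ · ξ(S(h₂) · x)` (`indTensor_right`).

A colinear bimodule isomorphism `φ_M` carries this formula to `M ⊗ H`. There, evaluating at `m ⊗ h`
and applying the counit to `H` gives `Ψ(h) m = ε(h) ξ(x) m` (`StableIso.twist_apply`). By
faithfulness `Ψ(h) = ε(h) ξ(x)`, and acting by the antipode solves this for `ξ(S(h) · x) = S(h) ·
ξ(x)` (`ModuleAlgebra.apply_eq_of_twist`). Since `S² = id`, `ξ` commutes with the action of `H`.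

Cohomology. The `H`-equivariant automorphisms form a subgroup, so equivariance passes from the
generators to all of `PicH` (`picCenter_mem_aut`). Composition with an algebra automorphism respects
convolution and commutes with every face; it commutes with the remaining term `h₀ · f(⋯)` of the
differential by equivariance (`sweedlerD_smul`). So it preserves cocycles and coboundaries and
descends to cohomology. -/

theorem IsBilinear.regular_apply {f : regular k B →ₗ[k] regular k B} (hf : IsBilinear f)
    (z : regular k B) :
    f z = (regular k B).left (show B from f (unit k B)) z := by
  have h := hf.2 (op (show B from z)) (unit k B)
  rw [right_unit] at h
  exact h

/-- Right linearity gives `f(b) = f(1) b` and left linearity gives `f(b) = b f(1)`. -/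
theorem IsBilinear.unit_mem_center {f : regular k B →ₗ[k] regular k B} (hf : IsBilinear f) :
    (show B from f (unit k B)) ∈ Subalgebra.center k B := by
  refine Subalgebra.mem_center_iff.2 fun b => ?_
  have h := hf.1 b (unit k B)
  rw [left_unit] at h
  exact h.symm.trans (hf.regular_apply b)

/-- A bimodule `M` is faithful on the left if `M ⊗_B N ≅ B` for some `N`. -/
theorem left_injective_of_tensor {M N : Bimodule.{u, v, v} k B}
    (e : (M.tensor N).Iso (regular k B)) {x y : B} (h : ∀ m, M.left x m = M.left y m) : x = y := by
  have key : ∀ z, (M.tensor N).left x z = (M.tensor N).left y z := by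
    intro z
    induction z using tensor_induction with
    | tmul m n => rw [tensor_left, tensor_left, h]
    | add z z' hz hz' => rw [map_add, map_add, hz, hz']
  -- The element of `M ⊗ N` corresponding to `1 ∈ B` separates the elements of `B`.
  have h1 := key (e.symm.toEquiv (unit k B))
  rw [← e.symm.map_left, ← e.symm.map_left] at h1
  have h2 := e.symm.toEquiv.injective h1
  rwa [left_unit, left_unit] at h2

/-- Bimodule endomorphisms of an invertible bimodule are given by central elements. -/
theorem exists_center_of_isBilinear {M N : Bimodule.{u, v, v} k B}
    (e : (M.tensor N).Iso (regular k B)) (e' : (N.tensor M).Iso (regular k B))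
    {f : M →ₗ[k] M} (hf : IsBilinear f) :
    ∃ y : Subalgebra.center k B, ∀ m, f m = M.left y m := by
  -- Transported along `M ⊗ N ≅ B`, the map `f ⊗ id` becomes a bimodule endomorphism `G` of `B`; the
  -- required central element is `G(1)`.
  let F : M.tensor N →ₗ[k] M.tensor N := mapTensor f LinearMap.id hf ⟨fun _ _ => rfl, fun _ _ => rfl⟩
  have hFt (m : M) (n : N) : F (tmul M N m n) = tmul M N (f m) n := mapTensor_tmul _ _ _ _ _ _
  have hF : IsBilinear F := isBilinear_of_tmul (by simp [hFt, hf.1]) (by simp [hFt])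
  let G : regular k B →ₗ[k] regular k B := e.toEquiv.toLinearMap ∘ₗ F ∘ₗ e.symm.toEquiv.toLinearMap
  have hG : IsBilinear G :=
    ⟨fun b z => by simp [G, e.symm.map_left, hF.1, e.map_left, -regular_left],
     fun b z => by simp [G, e.symm.map_right, hF.2, e.map_right, -regular_right]⟩
  refine ⟨⟨_, hG.unit_mem_center⟩, fun m => ?_⟩
  set y : B := G (unit k B)
  have hy : ∀ z, F z = (M.tensor N).left y z := by
    intro z
    apply e.toEquiv.injective
    rw [e.map_left]
    have := hG.regular_apply (e.toEquiv z)
    refine Eq.trans ?_ this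
    simp [G, Iso.symm]
  -- Tensoring once more with `M` and reassociating leaves `N ⊗ M ≅ B` on the right, which can then
  -- be cancelled.
  have h1 : ∀ n m', tmul M (N.tensor M) (f m) (tmul N M n m') =
      tmul M (N.tensor M) (M.left y m) (tmul N M n m') := by
    intro n m'
    have h2 := congrArg (fun z => (tensorAssoc M N M).toEquiv (tmul (M.tensor N) M z m'))
      (hy (tmul M N m n))
    have h3 : ∀ (a : M) (b : N) (c : M), (tensorAssoc M N M).toEquiv (tmul (M.tensor N) M
        (tmul M N a b) c) = tmul M (N.tensor M) a (tmul N M b c) := by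
      intro a b c
      simp [tensorAssoc, Iso.ofMaps]
    simpa [hFt, h3] using h2
  have h4 : ∀ z, tmul M (N.tensor M) (f m) z = tmul M (N.tensor M) (M.left y m) z := by
    intro z
    induction z using tensor_induction with
    | tmul n m' => exact h1 n m'
    | add z z' hz hz' => rw [tmul_add, tmul_add, hz, hz']
  -- Take for `z` the element corresponding to `1` under `e'`: then `a ⊗ z` goes to `a ⊗ 1`, hence
  -- to `a`. No compatibility between `e` and `e'` is needed, since each is only used to cancel.
  have h5 := congrArg (fun z => (rightUnitor M).toEquiv
    (((Iso.refl M).tensorCongr e').toEquiv z)) (h4 (e'.symm.toEquiv (unit k B)))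
  have h6 : ∀ a : M, (rightUnitor M).toEquiv (((Iso.refl M).tensorCongr e').toEquiv
      (tmul M (N.tensor M) a (e'.symm.toEquiv (unit k B)))) = a := by
    intro a
    have : ((Iso.refl M).tensorCongr e').toEquiv
        (tmul M (N.tensor M) a (e'.symm.toEquiv (unit k B))) = tmul M (regular k B) a (unit k B) := by
      simp [Iso.tensorCongr, Iso.ofMaps, Iso.refl, Iso.symm]
    rw [this]
    exact (tensorLift_tmul (rightHom M) rightHom_balanced a (unit k B)).trans (rightHom_unit a)
  simpa only [h6] using h5

/-- Compatibility with the left action is the bimodule axiom; compatibility with the right action is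
the centrality of `x`. -/
theorem isBilinear_right_center (M : Bimodule.{u, v, v} k B) (x : Subalgebra.center k B) :
    IsBilinear (M.right (op (x : B))) := by
  refine ⟨fun b m => (M.left_right _ _ _).symm, fun b m => ?_⟩
  rw [← right_mul_apply, ← right_mul_apply]
  congr 2
  exact unop_injective (Subalgebra.mem_center_iff.1 x.2 (unop b))

end Bimodule

/-! ### The action of the Picard group on the center -/

section PicardAction

variable {k : Type u} [Field k] {B : Type v} [Ring B] [Algebra k B]

open Bimodule

/-- `m x = y m` for all `m` in the bimodule `M`. -/
def CenterRel (M : Bimodule.{u, v, v} k B) (x y : Subalgebra.center k B) : Prop :=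
  ∀ m, M.right (op (x : B)) m = M.left (y : B) m

theorem CenterRel.of_iso {M N : Bimodule.{u, v, v} k B} (e : M.Iso N)
    {x y : Subalgebra.center k B} (h : CenterRel M x y) : CenterRel N x y := by
  intro n
  obtain ⟨m, rfl⟩ := e.toEquiv.surjective n
  rw [← e.map_left, ← e.map_right, h m]

theorem centerRel_iff_of_mk_eq {M N : Bimodule.{u, v, v} k B}
    (h : BimodClass.mk M = BimodClass.mk N) {x y : Subalgebra.center k B} :
    CenterRel M x y ↔ CenterRel N x y := by
  obtain ⟨e⟩ := Quotient.exact h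
  exact ⟨.of_iso e, .of_iso e.symm⟩

/-- The computation is `m ⊗ n x = m ⊗ y n = m y ⊗ n = z m ⊗ n`. The right-hand bimodule acts first,
so the action of `Pic B` is a left action. -/
theorem CenterRel.tensor {M N : Bimodule.{u, v, v} k B} {x y z : Subalgebra.center k B}
    (h : CenterRel N x y) (h' : CenterRel M y z) : CenterRel (M.tensor N) x z := by
  intro t
  induction t using tensor_induction with
  | tmul m n => rw [tensor_left, tensor_right, h n, ← tmul_act, h' m]
  | add t t' ht ht' => rw [map_add, map_add, ht, ht']

/-- `N` represents `p⁻¹`, and the two unit equations in the monoid of classes unfold to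
isomorphisms. These are not required to satisfy the associativity conditions of a Morita context. -/
theorem Pic.exists_iso (p : Pic k B) {M : Bimodule.{u, v, v} k B} (hM : (p : BimodClass k B) = .mk M) :
    ∃ N : Bimodule.{u, v, v} k B, Nonempty ((M.tensor N).Iso (regular k B)) ∧
      Nonempty ((N.tensor M).Iso (regular k B)) := by
  obtain ⟨N, hN⟩ := Quotient.exists_rep (p⁻¹).val
  refine ⟨N, Quotient.exact (s := bimodSetoid k B) ?_, Quotient.exact (s := bimodSetoid k B) ?_⟩
  · have := p.mul_inv
    rw [hM, ← hN] at this
    exact this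
  · have := p.inv_mul
    rw [hM, ← hN] at this
    exact this

theorem Pic.existsUnique_centerRel (p : Pic k B) {M : Bimodule.{u, v, v} k B}
    (hM : (p : BimodClass k B) = .mk M) (x : Subalgebra.center k B) : ∃! y, CenterRel M x y := by
  obtain ⟨N, ⟨e⟩, ⟨e'⟩⟩ := p.exists_iso hM
  obtain ⟨y, hy⟩ := exists_center_of_isBilinear e e' (isBilinear_right_center M x)
  exact ⟨y, hy, fun z hz => Subtype.ext <| left_injective_of_tensor e fun m => by
    rw [← hy, ← hz]⟩

/-- The image of the central element `x` under the action of `p ∈ Pic B`. -/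
def Pic.centerMap (p : Pic k B) (x : Subalgebra.center k B) : Subalgebra.center k B :=
  (p.existsUnique_centerRel (M := p.val.out) (Quotient.out_eq _).symm x).choose

/-- The definition uses a chosen representative of `p`. The relation `m x = y m` is invariant under
isomorphism, so any representative may be used to test it. -/
theorem Pic.centerMap_eq_iff (p : Pic k B) {M : Bimodule.{u, v, v} k B}
    (hM : (p : BimodClass k B) = .mk M) (x y : Subalgebra.center k B) :
    p.centerMap x = y ↔ CenterRel M x y := by
  have h := p.existsUnique_centerRel (M := p.val.out) (Quotient.out_eq _).symm x
  rw [centerRel_iff_of_mk_eq (N := p.val.out) (hM.symm.trans (Quotient.out_eq _).symm)]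
  constructor
  · rintro rfl
    exact h.choose_spec.1
  · intro hy
    exact (h.choose_spec.2 y hy).symm

/-- The action of `p ∈ Pic B` on the center of `B` as an algebra endomorphism. -/
def Pic.centerHom (p : Pic k B) : Subalgebra.center k B →ₐ[k] Subalgebra.center k B :=
  have hp : (p : BimodClass k B) = .mk p.val.out := (Quotient.out_eq _).symm
  have spec (x) : CenterRel p.val.out x (p.centerMap x) := (p.centerMap_eq_iff hp _ _).1 rfl
  AlgHom.ofLinearMap
    { toFun := p.centerMap
      map_add' := fun x y => (p.centerMap_eq_iff hp _ _).2 fun m => by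
        simp [spec x m, spec y m]
      map_smul' := fun c x => (p.centerMap_eq_iff hp _ _).2 fun m => by
        simp [spec x m] }
    ((p.centerMap_eq_iff hp _ _).2 fun m => by simp)
    -- Here `m (x y) = (m x) y = (ξ(x) m) y = ξ(x) (m y) = ξ(x) ξ(y) m`, by the commutation of the
    -- two actions on `M`.
    (fun x y => (p.centerMap_eq_iff hp _ _).2 fun m => by
      change p.val.out.right (op ((x : B) * y)) m =
        p.val.out.left ((p.centerMap x : B) * p.centerMap y) m
      rw [op_mul, right_mul_apply, left_mul_apply, spec x, ← left_right, spec y])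

theorem Pic.centerHom_eq_iff (p : Pic k B) {M : Bimodule.{u, v, v} k B}
    (hM : (p : BimodClass k B) = .mk M) (x y : Subalgebra.center k B) :
    p.centerHom x = y ↔ CenterRel M x y :=
  p.centerMap_eq_iff hM x y

variable (k B) in
/-- The action of `Pic B` on the center of `B`. -/
def picCenter : Pic k B →* (Subalgebra.center k B ≃ₐ[k] Subalgebra.center k B) :=
  -- A monoid map from a group takes values in the units, so the endomorphisms `centerHom` are
  -- automorphisms without a separate argument.
  (AlgEquiv.algHomUnitsEquiv k (Subalgebra.center k B)).toMonoidHom.comp <| MonoidHom.toHomUnits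
    { toFun := Pic.centerHom
      map_one' := AlgHom.ext fun x =>
        (Pic.centerHom_eq_iff 1 (M := regular k B) rfl _ _).2 fun b =>
          Subalgebra.mem_center_iff.1 x.2 b
      map_mul' := fun p q => AlgHom.ext fun x => by
        have hp : (p : BimodClass k B) = .mk p.val.out := (Quotient.out_eq _).symm
        have hq : (q : BimodClass k B) = .mk q.val.out := (Quotient.out_eq _).symm
        refine (Pic.centerHom_eq_iff (p * q) (M := p.val.out.tensor q.val.out) ?_ _ _).2
          (.tensor ((q.centerHom_eq_iff hq _ _).1 rfl) ((p.centerHom_eq_iff hp _ _).1 rfl))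
        exact congrArg₂ (· * ·) hp hq }

theorem picCenter_eq_iff (p : Pic k B) {M : Bimodule.{u, v, v} k B}
    (hM : (p : BimodClass k B) = .mk M) (x y : Subalgebra.center k B) :
    picCenter k B p x = y ↔ CenterRel M x y :=
  p.centerHom_eq_iff hM x y

end PicardAction

/-! ### Equivariance of the action for stable contexts -/

section Equivariance

open Coalgebra HopfAlgebra ComoduleAlgebra

section MulBy

variable {k : Type*} [Field k] {E E' X X' : Type*} [Ring E] [Algebra k E] [Ring E'] [Algebra k E']
variable [AddCommGroup X] [Module k X] [AddCommGroup X'] [Module k X']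

/-- `e ⊗ x ↦ e F(x)` -/
def rightMulBy (F : X →ₗ[k] E) : E ⊗[k] X →ₗ[k] E :=
  LinearMap.mul' k E ∘ₗ F.lTensor E

/-- `e ⊗ x ↦ F(x) e` -/
def leftMulBy (F : X →ₗ[k] E) : E ⊗[k] X →ₗ[k] E :=
  LinearMap.mul' k E ∘ₗ (TensorProduct.comm k E E).toLinearMap ∘ₗ F.lTensor E

@[simp] theorem rightMulBy_tmul (F : X →ₗ[k] E) (e : E) (x : X) :
    rightMulBy F (e ⊗ₜ x) = e * F x := rfl

@[simp] theorem leftMulBy_tmul (F : X →ₗ[k] E) (e : E) (x : X) :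
    leftMulBy F (e ⊗ₜ x) = F x * e := rfl

/-- Applied with `f = boxVal`, this and `map_leftMulBy` reduce identities in `A □ Aᵐᵒᵖ` to
identities in `A ⊗ Aᵐᵒᵖ`. -/
theorem map_rightMulBy (f : E →ₐ[k] E') (F : X →ₗ[k] E) (z : E ⊗[k] X) :
    f (rightMulBy F z) = rightMulBy (f.toLinearMap ∘ₗ F) (f.toLinearMap.rTensor X z) := by
  induction z with
  | zero => simp
  | tmul e x => simp
  | add z z' hz hz' => simp only [map_add, hz, hz']

theorem map_leftMulBy (f : E →ₐ[k] E') (F : X →ₗ[k] E) (z : E ⊗[k] X) :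
    f (leftMulBy F z) = leftMulBy (f.toLinearMap ∘ₗ F) (f.toLinearMap.rTensor X z) := by
  induction z with
  | zero => simp
  | tmul e x => simp
  | add z z' hz hz' => simp only [map_add, hz, hz']

end MulBy

/-! ### Inverting the twist in a module algebra -/

section ModuleAlgebra

variable {k : Type*} {H R : Type*} [Field k] [Ring H] [CommRing R] [Algebra k R]

/-- `h ↦ h₁ · F(h₂)` -/
def ModuleAlgebra.twist [Bialgebra k H] (ma : ModuleAlgebra k H R) (F : H →ₗ[k] R) : H →ₗ[k] R :=
  TensorProduct.lift (ma.act.compl₂ F) ∘ₗ comul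

/-- If `h₁ · F(h₂) = ε(h) r` for all `h`, then `F(h) = S(h) · r`. -/
theorem ModuleAlgebra.apply_eq_of_twist [HopfAlgebra k H] (ma : ModuleAlgebra k H R)
    (F : H →ₗ[k] R) (r : R) (h : ∀ h, ma.twist F h = counit (R := k) h • r) (g : H) :
    F g = ma.act (antipode k g) r := by
  -- `V(a ⊗ b ⊗ c) = S(a) · (b · F(c))` is evaluated on `g₁ ⊗ g₂ ⊗ g₃` in two ways. Grouping the
  -- last two factors gives `S(g) · r` by hypothesis (`h1`); grouping the first two gives `S(g₁) g₂
  -- · F(g₃) = F(g)` (`h2`).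
  let V : H ⊗[k] (H ⊗[k] H) →ₗ[k] R :=
    TensorProduct.lift ((ma.act ∘ₗ antipode k).compl₂ (TensorProduct.lift (ma.act.compl₂ F)))
  have h1 : ∀ z : H ⊗[k] H, V ((comul (R := k) (A := H)).lTensor H z) =
      ma.act (antipode k (TensorProduct.rid k H ((counit (R := k) (A := H)).lTensor H z))) r := by
    intro z
    induction z with
    | zero => simp
    | add z z' hz hz' => simp only [map_add, hz, hz', LinearMap.add_apply]
    | tmul a b =>
      have : V (a ⊗ₜ comul (R := k) b) = ma.act (antipode k a) (ma.twist F b) := rfl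
      rw [LinearMap.lTensor_tmul, this, h]
      simp
  have h2 : ∀ z : H ⊗[k] H, V (TensorProduct.assoc k H H H ((comul (R := k) (A := H)).rTensor H z)) =
      F (TensorProduct.lid k H ((counit (R := k) (A := H)).rTensor H z)) := by
    intro z
    induction z with
    | zero => simp
    | add z z' hz hz' => simp only [map_add, hz, hz']
    | tmul a b =>
      have h3 : ∀ w : H ⊗[k] H, V (TensorProduct.assoc k H H H (w ⊗ₜ b)) =
          ma.act (LinearMap.mul' k H ((antipode k).rTensor H w)) (F b) := by
        intro w
        induction w with
        | zero => simp
        | add w w' hw hw' => simp only [map_add, hw, hw', TensorProduct.add_tmul, LinearMap.add_apply]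
        | tmul c d => simp [V, ma.mul_act]
      rw [LinearMap.rTensor_tmul, h3, mul_antipode_rTensor_comul_apply]
      simp [Algebra.algebraMap_eq_smul_one, ma.one_act]
  have h4 := h2 (comul g)
  rw [coassoc_apply, h1] at h4
  simpa using h4.symm

end ModuleAlgebra

/-! ### Moving central elements across `A` and `A □ Aᵐᵒᵖ` -/

section Commutation

variable {k : Type u} {H : Type w} {A : Type v} [Field k] [Ring H] [HopfAlgebra k H]
variable [Ring A] [Algebra k A] [ComoduleAlgebra k H A]

variable (k H A) in
/-- The inclusion of `Z(B)` in `A`. -/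
def centerIncl : CenterB k H A →ₐ[k] A := (coinv k H A).val.comp CenterB.val

theorem rightMulBy_mu (hA : IsFaithfullyFlatGalois k H A) (y : Subalgebra.center k (coinv k H A))
    (a : A) : rightMulBy (mu hA y) (coact a) = y * a :=
  ev_mu hA y a

theorem coactL_tmul (a : A) (c : Aᵐᵒᵖ) : coactL k H A Aᵐᵒᵖ (a ⊗ₜ c) =
    TensorProduct.rightComm k A H Aᵐᵒᵖ (coact (k := k) (H := H) a ⊗ₜ c) := by
  simp only [coactL, AlgHom.comp_apply, Algebra.TensorProduct.map_tmul, AlgHom.id_apply]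
  generalize coact (k := k) (H := H) a = y
  induction y with
  | zero => simp
  | add y y' hy hy' => simp only [map_add, TensorProduct.add_tmul, hy, hy']
  | tmul d g => simp

/-- `p ⊗ h ↦ F(h) p`, for a bimodule `P` and `F : H → Z(B)` -/
def leftActBy (P : Bimodule.{u, v, w'} k (coinv k H A)) (F : H →ₗ[k] CenterB k H A) :
    P ⊗[k] H →ₗ[k] P :=
  TensorProduct.lift (P.left.toLinearMap ∘ₗ CenterB.val.toLinearMap ∘ₗ F).flip

@[simp] theorem leftActBy_tmul (P : Bimodule.{u, v, w'} k (coinv k H A))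
    (F : H →ₗ[k] CenterB k H A) (p : P) (h : H) :
    leftActBy P F (p ⊗ₜ h) = P.left (F h).val p := rfl

/-- This transports a formula for the right action in terms of the coaction along `φ_M`. -/
theorem map_leftActBy {P : Bimodule.{u, v, w'} k (coinv k H A)}
    {Q : Bimodule.{u, v, w''} k (coinv k H A)} (e : P.Iso Q)
    (F : H →ₗ[k] CenterB k H A) (z : P ⊗[k] H) :
    e.toEquiv (leftActBy P F z) = leftActBy Q F (e.toEquiv.toLinearMap.rTensor H z) := by
  induction z with
  | zero => simp
  | add z z' hz hz' => simp only [map_add, hz, hz']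
  | tmul p h => exact e.map_left _ _

variable [IsCocomm k H] (hA : IsFaithfullyFlatGalois k H A)

theorem centerIncl_act (h : H) (x : CenterB k H A) :
    centerIncl k H A ((miyashitaUlbrich hA).act h x) = mu hA x (antipode k h) := rfl

/-- `a y = (a₁ · y) a₀` -/
theorem leftMulBy_mu (y : Subalgebra.center k (coinv k H A)) (a : A) :
    leftMulBy (mu hA y ∘ₗ antipode k) (coact a) = a * y := by
  -- `W(a ⊗ h ⊗ g) = a · mu y (S(g) h)`. Both sides of the claim are read off from the value of `W`
  -- on `a₀ ⊗ a₁ ⊗ a₂`.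
  let W : A ⊗[k] (H ⊗[k] H) →ₗ[k] A :=
    rightMulBy (mu hA y ∘ₗ LinearMap.mul' k H ∘ₗ (antipode k).rTensor H ∘ₗ
      (TensorProduct.comm k H H).toLinearMap)
  have h1 : ∀ z : A ⊗[k] H, leftMulBy (mu hA y ∘ₗ antipode k) z =
      W (TensorProduct.assoc k A H H (coact.toLinearMap.rTensor H z)) := by
    intro z
    induction z with
    | zero => simp
    | add z z' hz hz' => simp only [map_add, hz, hz']
    | tmul c g =>
      -- The element `mu y (S(g))` is again central in `B`, so it can be moved past `c` by
      -- `rightMulBy_mu`; the two Miyashita-Ulbrich actions then combine to that of `S(g) e`.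
      have h2 : ∀ w : A ⊗[k] H, rightMulBy (mu hA (muRight hA y (antipode k g))) w =
          W (TensorProduct.assoc k A H H (w ⊗ₜ g)) := by
        intro w
        induction w with
        | zero => simp
        | add w w' hw hw' => simp only [map_add, TensorProduct.add_tmul, hw, hw']
        | tmul d e => simp [W, mu_mul_right]
      rw [LinearMap.rTensor_tmul, AlgHom.toLinearMap_apply, ← h2]
      exact (rightMulBy_mu hA (muRight hA y (antipode k g)) c).symm
  -- The factors occur as `S(g₂) g₁`; cocommutativity turns this into `S(g₁) g₂ = ε(g)`.
  have h3 : ∀ z : A ⊗[k] H, W ((comul (R := k) (A := H)).lTensor A z) =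
      TensorProduct.rid k A ((counit (R := k) (A := H)).lTensor A z) * y := by
    intro z
    induction z with
    | zero => simp
    | add z z' hz hz' => simp only [map_add, hz, hz', add_mul]
    | tmul c g =>
      simp only [W, LinearMap.lTensor_tmul, rightMulBy_tmul, LinearMap.comp_apply,
        LinearEquiv.coe_coe, comm_comul, mul_antipode_rTensor_comul_apply]
      rw [Algebra.algebraMap_eq_smul_one, map_smul, mu_one_right]
      simp
  rw [h1, coact_coassoc, h3, coact_counit]

/-- `a₀ F(a₁) = (a₁ · F(a₂)) a₀` -/
theorem rightMulBy_coact (F : H →ₗ[k] CenterB k H A) (a : A) :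
    rightMulBy ((centerIncl k H A).toLinearMap ∘ₗ F) (coact a) =
      leftMulBy ((centerIncl k H A).toLinearMap ∘ₗ (miyashitaUlbrich hA).twist F)
        (coact (k := k) (H := H) a) := by
  -- `Q(a ⊗ h ⊗ g) = (h · F(g)) a`. Moving `F(a₁)` to the left of `a₀` by `leftMulBy_mu` produces
  -- `Q` on the twofold coaction of `a`, and coassociativity turns the inner sum into the twist of
  -- `F`.
  let Q : A ⊗[k] (H ⊗[k] H) →ₗ[k] A :=
    leftMulBy ((centerIncl k H A).toLinearMap ∘ₗ
      TensorProduct.lift ((miyashitaUlbrich hA).act.compl₂ F))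
  have h1 : ∀ z : A ⊗[k] H, rightMulBy ((centerIncl k H A).toLinearMap ∘ₗ F) z =
      Q (TensorProduct.assoc k A H H (coact.toLinearMap.rTensor H z)) := by
    intro z
    induction z with
    | zero => simp
    | add z z' hz hz' => simp only [map_add, hz, hz']
    | tmul c g =>
      have h2 : ∀ w : A ⊗[k] H, leftMulBy (mu hA (F g) ∘ₗ antipode k) w =
          Q (TensorProduct.assoc k A H H (w ⊗ₜ g)) := by
        intro w
        induction w with
        | zero => simp
        | add w w' hw hw' => simp only [map_add, TensorProduct.add_tmul, hw, hw']
        | tmul d e => simp [Q, centerIncl_act]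
      rw [LinearMap.rTensor_tmul, AlgHom.toLinearMap_apply, ← h2]
      exact (leftMulBy_mu hA (F g) c).symm
  have h3 : ∀ z : A ⊗[k] H, Q ((comul (R := k) (A := H)).lTensor A z) =
      leftMulBy ((centerIncl k H A).toLinearMap ∘ₗ (miyashitaUlbrich hA).twist F) z := by
    intro z
    induction z with
    | zero => simp
    | add z z' hz hz' => simp only [map_add, hz, hz']
    | tmul c g => rfl
  rw [h1, coact_coassoc, h3]

theorem coactR_tmul_op (a a' : A) : coactR k H A Aᵐᵒᵖ (a ⊗ₜ op a') =
    (TensorProduct.assoc k A Aᵐᵒᵖ H).symm (a ⊗ₜ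
      TensorProduct.map (opLinearEquiv k).toLinearMap (antipode k) (coact (k := k) (H := H) a')) := by
  rw [← coactOp_op]
  rfl

/-- Left multiplication by `op x` in `Aᵐᵒᵖ` is right multiplication by `x` in `A`, so `leftMulBy_mu`
applies to the second factor. Its antipode is the one already contained in the coaction of `Aᵐᵒᵖ`,
so the map on `H` is `mu hA x` itself. -/
theorem includeRight_mul_eq (x : CenterB k H A) (t : A ⊗[k] Aᵐᵒᵖ) :
    ((1 : A) ⊗ₜ[k] op (centerIncl k H A x)) * t =
      rightMulBy ((TensorProduct.mk k A Aᵐᵒᵖ 1) ∘ₗ (opLinearEquiv k).toLinearMap ∘ₗ mu hA x)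
        (coactR k H A Aᵐᵒᵖ t) := by
  induction t with
  | zero => simp
  | add t t' ht ht' => simp only [map_add, mul_add, ht, ht']
  | tmul a c =>
    induction c using MulOpposite.rec' with | _ a'
    have h : ∀ w : A ⊗[k] H, rightMulBy ((TensorProduct.mk k A Aᵐᵒᵖ 1) ∘ₗ
        (opLinearEquiv k).toLinearMap ∘ₗ mu hA x) ((TensorProduct.assoc k A Aᵐᵒᵖ H).symm (a ⊗ₜ
          TensorProduct.map (opLinearEquiv k).toLinearMap (antipode k) w)) =
        a ⊗ₜ op (leftMulBy (mu hA x ∘ₗ antipode k) w) := by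
      intro w
      induction w with
      | zero => simp
      | add w w' hw hw' => simp only [map_add, TensorProduct.tmul_add, hw, hw', op_add]
      | tmul d e => simp
    rw [coactR_tmul_op, h, Algebra.TensorProduct.tmul_mul_tmul, one_mul]
    exact congrArg (fun c => a ⊗ₜ[k] op c) (leftMulBy_mu hA x a').symm

/-- Only the first tensor factor is involved, and there the rule is `rightMulBy_coact`. -/
theorem rightMulBy_coactL (F : H →ₗ[k] CenterB k H A) (t : A ⊗[k] Aᵐᵒᵖ) :
    rightMulBy ((TensorProduct.mk k A Aᵐᵒᵖ).flip 1 ∘ₗ (centerIncl k H A).toLinearMap ∘ₗ F)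
        (coactL k H A Aᵐᵒᵖ t) =
      leftMulBy ((TensorProduct.mk k A Aᵐᵒᵖ).flip 1 ∘ₗ (centerIncl k H A).toLinearMap ∘ₗ
        (miyashitaUlbrich hA).twist F) (coactL k H A Aᵐᵒᵖ t) := by
  induction t with
  | zero => simp
  | add t t' ht ht' => simp only [map_add, ht, ht']
  | tmul a c =>
    have h1 : ∀ (G : H →ₗ[k] A) (w : A ⊗[k] H),
        rightMulBy ((TensorProduct.mk k A Aᵐᵒᵖ).flip 1 ∘ₗ G)
          (TensorProduct.rightComm k A H Aᵐᵒᵖ (w ⊗ₜ c)) = rightMulBy G w ⊗ₜ c := by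
      intro G w
      induction w with
      | zero => simp
      | add w w' hw hw' => simp only [map_add, TensorProduct.add_tmul, hw, hw']
      | tmul d e => simp
    have h2 : ∀ (G : H →ₗ[k] A) (w : A ⊗[k] H),
        leftMulBy ((TensorProduct.mk k A Aᵐᵒᵖ).flip 1 ∘ₗ G)
          (TensorProduct.rightComm k A H Aᵐᵒᵖ (w ⊗ₜ c)) = leftMulBy G w ⊗ₜ c := by
      intro G w
      induction w with
      | zero => simp
      | add w w' hw hw' => simp only [map_add, TensorProduct.add_tmul, hw, hw']
      | tmul d e => simp
    rw [coactL_tmul, h1, h2, rightMulBy_coact hA]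

variable (k H A) in
/-- `x ↦ x ⊗ 1`, from `Z(B)` to `A □ Aᵐᵒᵖ` -/
def boxInl : CenterB k H A →ₗ[k] BoxEnv k H A :=
  (envIncl k H A).toLinearMap ∘ₗ
    (TensorProduct.mk k (coinv k H A) (coinv k H A)ᵐᵒᵖ).flip 1 ∘ₗ CenterB.val.toLinearMap

variable (k H A) in
/-- `x ↦ 1 ⊗ x`, from `Z(B)` to `A □ Aᵐᵒᵖ` -/
def boxInr : CenterB k H A →ₗ[k] BoxEnv k H A :=
  (envIncl k H A).toLinearMap ∘ₗ TensorProduct.mk k (coinv k H A) (coinv k H A)ᵐᵒᵖ 1 ∘ₗ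
    (opLinearEquiv k).toLinearMap ∘ₗ CenterB.val.toLinearMap

theorem boxVal_boxInr (x : CenterB k H A) :
    boxVal k H A (boxInr k H A x) = 1 ⊗ₜ op (centerIncl k H A x) := rfl

theorem boxVal_injective : Function.Injective (boxVal k H A) := Subtype.val_injective

/-- The cotensor condition is what makes this work: the scalar is moved past the second factor at
the cost of the coaction of that factor, which on `A □ Aᵐᵒᵖ` equals the coaction of the first. The
antipode appears because `mu hA x h = S(h) · x`. -/
theorem boxInr_mul (x : CenterB k H A) (t : BoxEnv k H A) :
    boxInr k H A x * t =
      rightMulBy (boxInr k H A ∘ₗ (miyashitaUlbrich hA).act.flip x ∘ₗ antipode k)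
        (boxCoact k H A t) := by
  apply boxVal_injective
  have ht : coactL k H A Aᵐᵒᵖ (boxVal k H A t) = coactR k H A Aᵐᵒᵖ (boxVal k H A t) := t.2
  rw [map_mul, map_rightMulBy, rTensor_boxCoact, ht, boxVal_boxInr, includeRight_mul_eq hA]
  congr 2
  ext h
  simp only [LinearMap.comp_apply, AlgHom.toLinearMap_apply, boxVal_boxInr, LinearMap.flip_apply,
    centerIncl_act, antipode_antipode]
  rfl

theorem rightMulBy_boxCoact (F : H →ₗ[k] CenterB k H A) (t : BoxEnv k H A) :
    rightMulBy (boxInl k H A ∘ₗ F) (boxCoact k H A t) =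
      leftMulBy (boxInl k H A ∘ₗ (miyashitaUlbrich hA).twist F) (boxCoact k H A t) := by
  apply boxVal_injective
  rw [map_rightMulBy, map_leftMulBy, rTensor_boxCoact]
  exact rightMulBy_coactL hA F _

/-! ### Transport to the bimodule `M` along a stable isomorphism -/

section
variable {M : Bimodule.{u, v, v} k (coinv k H A)}

theorem indTensor_right_indTmul (x : CenterB k H A) (t : BoxEnv k H A) (m : M) :
    (indTensor k H M).right (op x.val) (indTmul H M t m) = indTmul H M (boxInr k H A x * t) m := rfl

theorem indTensor_left_indTmul (x : CenterB k H A) (t : BoxEnv k H A) (m : M) :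
    (indTensor k H M).left x.val (indTmul H M t m) = indTmul H M (boxInl k H A x * t) m := rfl

/-- Factors from `B ⊗ Bᵐᵒᵖ` on the right of `t` cross the tensor sign. Together with
`indTmul_mul_boxInr` this lets `m y = ξ(y) m` exchange `1 ⊗ y` for `ξ(y) ⊗ 1` inside `A □ Aᵐᵒᵖ`. -/
theorem indTmul_mul_boxInl (x : CenterB k H A) (t : BoxEnv k H A) (m : M) :
    indTmul H M (t * boxInl k H A x) m = indTmul H M t (M.left x.val m) := by
  refine (boxRight_indTmul t (x.val ⊗ₜ 1) m).trans ?_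
  simp

theorem indTmul_mul_boxInr (x : CenterB k H A) (t : BoxEnv k H A) (m : M) :
    indTmul H M (t * boxInr k H A x) m = indTmul H M t (M.right (op x.val) m) := by
  refine (boxRight_indTmul t (1 ⊗ₜ op x.val) m).trans ?_
  simp

theorem indTensor_induction {p : indTensor k H M → Prop} (tmul : ∀ t m, p (indTmul H M t m))
    (add : ∀ z z', p z → p z' → p (z + z')) (z : indTensor k H M) : p z :=
  Balanced.induction tmul add z

/-- On `(A □ Aᵐᵒᵖ) ⊗ M`, the right action of a central `x` is `z x = (z₁ · ξ(S(z₂) · x)) z₀`, if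
`m y = ξ(y) m` on `M`. -/
theorem indTensor_right (ξ : CenterB k H A →ₗ[k] CenterB k H A)
    (hξ : ∀ y m, M.right (op (CenterB.val y)) m = M.left (ξ y).val m) (x : CenterB k H A)
    (z : indTensor k H M) :
    (indTensor k H M).right (op x.val) z = leftActBy (indTensor k H M)
      ((miyashitaUlbrich hA).twist (ξ ∘ₗ (miyashitaUlbrich hA).act.flip x ∘ₗ antipode k))
      (indCoact H M z) := by
  induction z using indTensor_induction with
  | add z z' hz hz' => simp only [map_add, hz, hz']
  | tmul t m =>
    set G := (miyashitaUlbrich hA).act.flip x ∘ₗ antipode k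
    -- The scalar goes over to `M` as a right factor, turns into a left factor under `ξ`, and comes
    -- back in the first tensor factor of `A □ Aᵐᵒᵖ`.
    have h1 : ∀ w, indTmul H M (rightMulBy (boxInr k H A ∘ₗ G) w) m =
        indTmul H M (rightMulBy (boxInl k H A ∘ₗ ξ ∘ₗ G) w) m := by
      intro w
      induction w with
      | zero => simp
      | add w w' hw hw' => simp only [map_add, LinearMap.add_apply, hw, hw']
      | tmul s h =>
        simp only [rightMulBy_tmul, LinearMap.comp_apply, indTmul_mul_boxInl, indTmul_mul_boxInr, hξ]
    have h2 : ∀ (F : H →ₗ[k] CenterB k H A) (w : BoxEnv k H A ⊗[k] H),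
        indTmul H M (leftMulBy (boxInl k H A ∘ₗ F) w) m =
        leftActBy (indTensor k H M) F (((indTmul H M).flip m).rTensor H w) := by
      intro F w
      induction w with
      | zero => simp
      | add w w' hw hw' => simp only [map_add, LinearMap.add_apply, hw, hw']
      | tmul s h => exact (indTensor_left_indTmul (F h) s m).symm
    rw [indTensor_right_indTmul, boxInr_mul hA, h1, rightMulBy_boxCoact hA, h2, indCoact_indTmul]

/-- Through `φ`, the formula of `indTensor_right` becomes `m x ⊗ h = Ψ(h₂) m ⊗ h₁` on `M ⊗ H`.
Applying the counit to the factor `H` leaves `ε(h) m x = Ψ(h) m`. -/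
theorem StableIso.twist_apply (φ : StableIso H M) (ξ : CenterB k H A →ₗ[k] CenterB k H A)
    (hξ : ∀ y m, M.right (op (CenterB.val y)) m = M.left (ξ y).val m) (x : CenterB k H A)
    (h : H) (m : M) :
    M.left ((miyashitaUlbrich hA).twist
      (ξ ∘ₗ (miyashitaUlbrich hA).act.flip x ∘ₗ antipode k) h).val m =
    M.left (counit (R := k) h • ξ x).val m := by
  set Ψ := (miyashitaUlbrich hA).twist (ξ ∘ₗ (miyashitaUlbrich hA).act.flip x ∘ₗ antipode k)
  have h1 : ∀ y : tensorH H M, (tensorH H M).right (op x.val) y =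
      leftActBy (tensorH H M) Ψ (tensorHCoact H M y) := by
    intro y
    obtain ⟨z, rfl⟩ := φ.toEquiv.surjective y
    rw [φ.colinear, ← map_leftActBy φ.toIso, ← indTensor_right hA ξ hξ]
    exact (φ.toIso.map_right _ _).symm
  let E : tensorH H M →ₗ[k] M :=
    (TensorProduct.rid k M).toLinearMap ∘ₗ (counit (R := k) (A := H)).lTensor M
  -- `K(m ⊗ a ⊗ b) = ε(a) Ψ(b) m`, so on `m ⊗ h₁ ⊗ h₂` it gives `Ψ(h) m` by counitality.
  let K : M ⊗[k] (H ⊗[k] H) →ₗ[k] M :=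
    E ∘ₗ leftActBy (tensorH H M) Ψ ∘ₗ (TensorProduct.assoc k M H H).symm.toLinearMap
  have h2 : ∀ w : H ⊗[k] H, K (m ⊗ₜ w) =
      M.left (Ψ (TensorProduct.lid k H ((counit (R := k) (A := H)).rTensor H w))).val m := by
    intro w
    induction w with
    | zero => simp
    | add w w' hw hw' => simp only [map_add, TensorProduct.tmul_add, hw, hw', LinearMap.add_apply]
    | tmul a b =>
      have : K (m ⊗ₜ (a ⊗ₜ b)) = counit (R := k) a • M.left (Ψ b).val m := rfl
      rw [this]
      simp
  have h3 := congrArg E (h1 (m ⊗ₜ[k] h))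
  have h4 := h2 (comul h)
  rw [rTensor_counit_comul, TensorProduct.lid_tmul, one_smul] at h4
  refine h4.symm.trans (h3.symm.trans ?_)
  change counit (R := k) h • M.right (op x.val) m = _
  rw [hξ]
  simp

end

/-- The action of the class of an `H`-stable Morita context on the center of the coinvariants is
`H`-equivariant. -/
theorem picCenter_act {C : MoritaContext k (coinv k H A)} (hC : C.IsHStable hA) (h : H)
    (x : CenterB k H A) :
    picCenter k (coinv k H A) C.toPic ((miyashitaUlbrich hA).act h x) =
      (miyashitaUlbrich hA).act h (picCenter k (coinv k H A) C.toPic x) := by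
  obtain ⟨φ, -⟩ := hC
  let ξ : CenterB k H A →ₗ[k] CenterB k H A := (picCenter k (coinv k H A) C.toPic).toLinearMap
  have hξ : ∀ y m, C.M.right (op (CenterB.val y)) m = C.M.left (ξ y).val m := fun y =>
    (picCenter_eq_iff C.toPic (M := C.M) rfl y (ξ y)).1 rfl
  -- Elements of `B` acting equally on `C.M` coincide, which removes `m` from
  -- `StableIso.twist_apply`. The conclusion `ξ(S(g) · x) = S(g) · ξ(x)` is taken at `g = S(h)`,
  -- where `S² = id` gives the claim.
  have key := (miyashitaUlbrich hA).apply_eq_of_twist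
    (ξ ∘ₗ (miyashitaUlbrich hA).act.flip x ∘ₗ antipode k) (ξ x)
    (fun g => Subtype.ext <| Bimodule.left_injective_of_tensor C.α fun m =>
      φ.twist_apply hA ξ hξ x g m) (antipode k h)
  simp only [LinearMap.comp_apply, antipode_antipode, LinearMap.flip_apply] at key
  exact key

end Commutation

end Equivariance

/-! ### Equivariant automorphisms and the Sweedler complex -/

section SweedlerAction

open Coalgebra

section
variable {k : Type u} {R : Type w} [Field k] [CommRing R] [Algebra k R]

/-- Composition with an algebra map, on convolution algebras. -/
def convPost (C : Type u) [AddCommGroup C] [Module k C] [Coalgebra k C] (σ : R →ₐ[k] R) :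
    WithConv (C →ₗ[k] R) →* WithConv (C →ₗ[k] R) where
  toFun f := .toConv (σ.toLinearMap ∘ₗ f.ofConv)
  map_one' := by ext c; simp
  map_mul' f g := by
    ext c
    simp only [LinearMap.convMul_apply, LinearMap.comp_apply]
    generalize comul (R := k) c = z
    induction z with
    | zero => simp
    | add z z' hz hz' => simp only [map_add, hz, hz']
    | tmul a b => simp

variable {H : Type u} [Ring H] [Bialgebra k H]

/-- Algebra automorphisms that commute with the action of `H`. -/
def ModuleAlgebra.aut (ma : ModuleAlgebra k H R) : Subgroup (R ≃ₐ[k] R) where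
  carrier := {σ | ∀ h x, σ (ma.act h x) = ma.act h (σ x)}
  one_mem' _ _ := rfl
  mul_mem' hσ hτ h x := by rw [AlgEquiv.mul_apply, hτ, hσ]; rfl
  inv_mem' {σ} hσ h x := by
    apply σ.injective
    rw [hσ]
    simp only [← AlgEquiv.mul_apply, mul_inv_cancel, AlgEquiv.one_apply]

theorem ModuleAlgebra.mem_aut {ma : ModuleAlgebra k H R} {σ : R ≃ₐ[k] R} :
    σ ∈ ma.aut ↔ ∀ h x, σ (ma.act h x) = ma.act h (σ x) := Iff.rfl

theorem convPost_convAct {ma : ModuleAlgebra k H R} (σ : ma.aut) (X : Type u)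
    [AddCommGroup X] [Module k X] [Coalgebra k X] (f : WithConv (X →ₗ[k] R)) :
    convPost (H ⊗[k] X) (σ : R ≃ₐ[k] R) (convAct ma X f) =
      convAct ma X (convPost X (σ : R ≃ₐ[k] R) f) := by
  ext h x
  exact ModuleAlgebra.mem_aut.1 σ.2 h _

variable [IsCocomm k H] (ma : ModuleAlgebra k H R)

/-- All algebra automorphisms act on cochains; equivariance is needed only for compatibility with
the differential. -/
instance cochainAction (n : ℕ) : MulDistribMulAction (R ≃ₐ[k] R) (Cochain k H R n) where
  smul σ := Units.map (convPost (TPow k H n) (σ : R →ₐ[k] R))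
  one_smul _ := rfl
  mul_smul _ _ _ := rfl
  smul_mul σ := map_mul (Units.map (convPost (TPow k H n) (σ : R →ₐ[k] R)))
  smul_one σ := map_one (Units.map (convPost (TPow k H n) (σ : R →ₐ[k] R)))

/-- The factor `h₀ · f(⋯)` is the only one that involves the action of `H`, and `convPost_convAct`
treats it. The other factors are obtained from `f` by composition with coalgebra maps on the source,
which commutes with composition by `σ` on the target. -/
theorem sweedlerD_smul (n : ℕ) (σ : ma.aut) (f : Cochain k H R n) :
    sweedlerD ma n ((σ : R ≃ₐ[k] R) • f) = (σ : R ≃ₐ[k] R) • sweedlerD ma n f := by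
  simp only [sweedlerD, MonoidHom.mul_apply, smul_mul', MonoidHom.finsetProd_apply,
    Finset.smul_prod', MonoidHom.zpow_apply]
  congr 1
  · exact Units.ext (convPost_convAct σ _ _).symm
  · refine Finset.prod_congr rfl fun i _ => ?_
    exact (map_zpow (MulDistribMulAction.toMonoidHom (Cochain k H R (n + 1)) (σ : R ≃ₐ[k] R))
      (Units.map (convComp R (face k H n i)) f) _).symm

theorem smul_mem_sweedlerZ {n : ℕ} (σ : ma.aut) {f : Cochain k H R n} (hf : f ∈ sweedlerZ ma n) :
    (σ : R ≃ₐ[k] R) • f ∈ sweedlerZ ma n := by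
  rw [sweedlerZ, MonoidHom.mem_ker] at hf ⊢
  rw [sweedlerD_smul, hf, smul_one]

theorem smul_mem_sweedlerB {n : ℕ} (σ : ma.aut) {f : Cochain k H R n} (hf : f ∈ sweedlerB ma n) :
    (σ : R ≃ₐ[k] R) • f ∈ sweedlerB ma n := by
  cases n with
  | zero =>
    rw [sweedlerB, Subgroup.mem_bot] at hf ⊢
    rw [hf, smul_one]
  | succ n =>
    obtain ⟨g, rfl⟩ := hf
    exact ⟨(σ : R ≃ₐ[k] R) • g, sweedlerD_smul ma n σ g⟩

end

/-! ### Induced actions on cocycles, coboundaries and cohomology -/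

section

/-- The restriction of an action by group automorphisms to an invariant subgroup. -/
abbrev restrictAction {G K X : Type*} [Group G] [Group K] [Group X] [MulDistribMulAction K X]
    (ρ : G →* K) (V : Subgroup X) (hV : ∀ g, ∀ x ∈ V, ρ g • x ∈ V) :
    MulDistribMulAction G V where
  smul g x := ⟨ρ g • (x : X), hV g x x.2⟩
  one_smul x := Subtype.ext <| by
    change ρ 1 • (x : X) = x
    rw [map_one, one_smul]
  mul_smul g g' x := Subtype.ext <| by
    change ρ (g * g') • (x : X) = ρ g • ρ g' • (x : X)
    rw [map_mul, mul_smul]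
  smul_mul g x y := Subtype.ext <| smul_mul' (ρ g) (x : X) y
  smul_one g := Subtype.ext <| smul_one (ρ g)

/-- The action induced on the quotient by an invariant normal subgroup. -/
abbrev quotientAction {G X : Type*} [Group G] [Group X] [MulDistribMulAction G X]
    (N : Subgroup X) [N.Normal] (hN : ∀ g : G, ∀ x ∈ N, g • x ∈ N) :
    MulDistribMulAction G (X ⧸ N) where
  smul g := QuotientGroup.map N N (MulDistribMulAction.toMonoidHom X g) (hN g)
  one_smul := by
    rintro ⟨x⟩
    exact congrArg _ (one_smul G x)
  mul_smul g g' := by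
    rintro ⟨x⟩
    exact congrArg _ (mul_smul g g' x)
  smul_mul g := map_mul (QuotientGroup.map N N (MulDistribMulAction.toMonoidHom X g) (hN g))
  smul_one g := map_one (QuotientGroup.map N N (MulDistribMulAction.toMonoidHom X g) (hN g))

variable {k : Type u} {H : Type u} {R : Type w} [Field k] [CommRing R] [Algebra k R]
variable [Ring H] [Bialgebra k H] [IsCocomm k H]

/-- A group acting by `H`-equivariant automorphisms on the module algebra `R` acts on the Sweedler
cocycles, coboundaries and cohomology with values in `R`. -/
theorem exists_sweedler_actions (ma : ModuleAlgebra k H R) {G : Type*} [Group G]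
    (ρ : G →* (R ≃ₐ[k] R)) (hρ : ∀ g, ρ g ∈ ma.aut) (n : ℕ) :
    ∃ (_ : MulDistribMulAction G (sweedlerZ ma n)) (_ : MulDistribMulAction G (sweedlerB ma n))
      (_ : MulDistribMulAction G (SweedlerH ma n)),
      (∀ (g : G) (f : sweedlerZ ma n) (t : TPow k H n),
        (g • f).val.val.ofConv t = ρ g (f.val.val.ofConv t)) ∧
      (∀ (g : G) (f : sweedlerB ma n) (t : TPow k H n),
        (g • f).val.val.ofConv t = ρ g (f.val.val.ofConv t)) ∧
      ∀ (g : G) (f : sweedlerZ ma n), g • SweedlerH.mk ma n f = SweedlerH.mk ma n (g • f) := by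
  -- This action is fixed first because the one on cohomology is defined as its quotient;
  -- compatibility with the class map is then definitional.
  let _ : MulDistribMulAction G (sweedlerZ ma n) := restrictAction ρ _
    fun g _ => smul_mem_sweedlerZ ma ⟨ρ g, hρ g⟩
  refine ⟨inferInstance, restrictAction ρ _ fun g _ => smul_mem_sweedlerB ma ⟨ρ g, hρ g⟩,
    quotientAction ((sweedlerB ma n).subgroupOf (sweedlerZ ma n)) fun g f hf => ?_,
    fun _ _ _ => rfl, fun _ _ _ => rfl, fun _ _ => rfl⟩
  exact smul_mem_sweedlerB ma ⟨ρ g, hρ g⟩ hf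

end

end SweedlerAction

/-- The elements of `Pic B` acting equivariantly form the preimage of the subgroup
`ModuleAlgebra.aut`. It contains the generators of `PicH` by `picCenter_act`, hence all of `PicH`.
-/
theorem picCenter_mem_aut {k H : Type u} {A : Type v} [Field k] [Ring H] [HopfAlgebra k H]
    [Coalgebra.IsCocomm k H] [Ring A] [Algebra k A] [ComoduleAlgebra k H A]
    (hA : IsFaithfullyFlatGalois k H A) {p : Pic k (coinv k H A)} (hp : p ∈ PicH hA) :
    (show CenterB k H A ≃ₐ[k] CenterB k H A from picCenter k (coinv k H A) p) ∈
      (miyashitaUlbrich hA).aut := by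
  let ρ : Pic k (coinv k H A) →* (CenterB k H A ≃ₐ[k] CenterB k H A) := picCenter k (coinv k H A)
  have h : PicH hA ≤ (miyashitaUlbrich hA).aut.comap ρ :=
    (Subgroup.closure_le _).2 fun _ ⟨_, hC, hCp⟩ => hCp ▸ picCenter_act hA hC
  exact h hp

end

end HPicard

/-- Let `H` be a cocommutative Hopf algebra and `A` a faithfully flat `H`-Galois extension of its
coinvariants `B`. The action `ξ` of `Pic B` on the center of `B` commutes on the `H`-stable part
with the Miyashita-Ulbrich action of `H`; it induces actions of the `H`-stable part on the Sweedler
cocycles, the Sweedler coboundaries and the Sweedler cohomology of `H` with values in the center. -/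
theorem proposition7p4 {k H : Type u} {A : Type v} [Field k] [Ring H] [HopfAlgebra k H]
    [Coalgebra.IsCocomm k H] [Ring A] [Algebra k A] [ComoduleAlgebra k H A]
    (hA : IsFaithfullyFlatGalois k H A) :
    ∃ ξ : Pic k (coinv k H A) →* (CenterB k H A ≃ₐ[k] CenterB k H A),
      (∀ (p : Pic k (coinv k H A)) (M : Bimodule.{u, v, v} k (coinv k H A)),
        (p : BimodClass k (coinv k H A)) = .mk M →
          ∀ x y : CenterB k H A,
            ξ p x = y ↔ ∀ m : M, M.right (op x.val) m = M.left y.val m) ∧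
      (∀ C : MoritaContext k (coinv k H A), C.IsHStable hA →
        ∀ (h : H) (x : CenterB k H A),
          ξ C.toPic ((miyashitaUlbrich hA).act h x) =
            (miyashitaUlbrich hA).act h (ξ C.toPic x)) ∧
      ∀ n : ℕ,
        ∃ (_ : MulDistribMulAction (PicH hA) (sweedlerZ (miyashitaUlbrich hA) n))
          (_ : MulDistribMulAction (PicH hA) (sweedlerB (miyashitaUlbrich hA) n))
          (_ : MulDistribMulAction (PicH hA) (SweedlerH (miyashitaUlbrich hA) n)),
          (∀ (p : PicH hA) (f : sweedlerZ (miyashitaUlbrich hA) n) (t : TPow k H n),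
            (p • f).val.val.ofConv t = ξ p (f.val.val.ofConv t)) ∧
          (∀ (p : PicH hA) (f : sweedlerB (miyashitaUlbrich hA) n) (t : TPow k H n),
            (p • f).val.val.ofConv t = ξ p (f.val.val.ofConv t)) ∧
          ∀ (p : PicH hA) (f : sweedlerZ (miyashitaUlbrich hA) n),
            p • SweedlerH.mk (miyashitaUlbrich hA) n f =
              SweedlerH.mk (miyashitaUlbrich hA) n (p • f) := by
  refine ⟨picCenter k (coinv k H A), fun p M hM x y => picCenter_eq_iff p hM x y,
    fun C hC h x => picCenter_act hA hC h x, fun n => ?_⟩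
  exact exists_sweedler_actions (miyashitaUlbrich hA)
    ((picCenter k (coinv k H A)).comp (PicH hA).subtype) (fun p => picCenter_mem_aut hA p.2) n
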